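/- Let $X$ be a reduced Noetherian scheme. A closed subvariety of $X$ is a reduced irreducible closed subscheme; by the components of a closed subset we mean its irreducible components, with reduced structure. A family $\mathcal P$ of closed subvarieties has the \emph{intersect-decompose property} if for every $S\subseteq\mathcal P$ all components of $\bigcap S$ belong to $\mathcal P$, where $\bigcap\emptyset=X$. Let $\mathcal P_X$ be the smallest such family (it is finite). Assume that for all $A\in\mathcal P_X$ and all $\{B_i\}\subseteq\mathcal P_X$ the scheme-theoretic intersection $A\cap\bigcup_i B_i$ is reduced. For a finite poset $P$ let $\mu_P:P\to\mathbb Z$ be its Möbius function, the unique function with $\sum_{q\ge p}\mu_P(q)=1$ for all $p\in P$; families of subvarieties are ordered by inclusion. Let $K_0(X)$ be the Grothendieck group of coherent sheaves on $X$, and for a closed subscheme $A$ let $[A]\in K_0(X)$ be the class of its structure sheaf. Let $\mathcal P$ be a finite family of closed subvarieties of $X$ with the intersect-decompose property (so that $\mathcal P\supseteq\mathcal P_X$). Then: (1) $[X]=\sum_{A\in\mathcal P}\mu_{\mathcal P}(A)\,[A]$ in $K_0(X)$. (2) For $A\in\mathcal P$, $\mu_{\mathcal P}(A)=0$ if $A\notin\mathcal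 P_X$, and $\mu_{\mathcal P}(A)=\mu_{\mathcal P_X}(A)$ if $A\in\mathcal P_X$. (3) Let $S$ be a scheme, $G$ a flat group scheme over $S$ (for example an algebraic group over a field, or an abstract group viewed as a constant group scheme), let $X$ be a scheme over $S$ by a morphism $X\to S$, and let $G$ act on $X$ over $S$ so that each $A\in\mathcal P$ is preserved, i.e. the action restricts to $G\times_S A\to A$. Then $[X]=\sum_{A\in\mathcal P}\mu_{\mathcal P}(A)\,[A]$ also holds in the Grothendieck group $K_0^G(X)$ of $G$-equivariant coherent sheaves on $X$, where the structure sheaf $\mathcal O_X$ has its canonical equivariant structure and each $\mathcal O_A$ has the equivariant structure for which $\mathcal O_X\to\mathcal O_A$ is equivariant. (4) If $G$ is a connected group scheme, locally of finite type over a field $k$, that acts on $X$ over $k$, then $G$ preserves each element of $\mathcal P_X$; so when $\mathcal P=\mathcal P_X$ the hypothesis of (3) is automatic. -/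

import Mathlib

open CategoryTheory AlgebraicGeometry MonoidalCategory CartesianMonoidalCategory TopologicalSpace

universe u

noncomputable section

/-! ## The Möbius function of a finite poset -/

/-- The Möbius function of a finite poset, by recursion from the maximal elements:
`μ p = 1 - ∑ q > p, μ q`. -/
def moebiusFn (P : Type*) [PartialOrder P] [Finite P] : P → ℤ :=
  (wellFounded_gt (α := P)).fix fun p μ => 1 - ∑ᶠ q : {q : P // p < q}, μ q.1 q.2

theorem moebiusFn_eq (P : Type*) [PartialOrder P] [Finite P] (p : P) :
    moebiusFn P p = 1 - ∑ᶠ q : {q : P // p < q}, moebiusFn P q.1 :=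
  (wellFounded_gt (α := P)).fix_eq _ p

/-- The defining property of the Möbius function: `∑ q ≥ p, μ q = 1` for every `p`. -/
theorem sum_moebiusFn (P : Type*) [PartialOrder P] [Fintype P] [DecidableLE P] (p : P) :
    ∑ q with p ≤ q, moebiusFn P q = 1 := by
  classical
  have h : (Finset.univ.filter fun q : P => p ≤ q)
      = insert p (Finset.univ.filter fun q : P => p < q) := by
    ext q
    simp [le_iff_eq_or_lt, eq_comm]
  rw [h, Finset.sum_insert (by simp), moebiusFn_eq P p, finsum_eq_sum_of_fintype,
    Finset.sum_subtype (Finset.univ.filter fun q : P => p < q) (p := fun q => p < q) (by simp)]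
  ring

/-- The defining property determines the Möbius function. -/
theorem eq_moebiusFn (P : Type*) [PartialOrder P] [Fintype P] [DecidableLE P] (f : P → ℤ)
    (hf : ∀ p, ∑ q with p ≤ q, f q = 1) : f = moebiusFn P := by
  classical
  funext p
  induction p using (wellFounded_gt (α := P)).induction with
  | _ p ih =>
    have h : (Finset.univ.filter fun q : P => p ≤ q)
        = insert p (Finset.univ.filter fun q : P => p < q) := by
      ext q
      simp [le_iff_eq_or_lt, eq_comm]
    have h1 := hf p
    have h2 := sum_moebiusFn P p
    rw [h, Finset.sum_insert (by simp)] at h1 h2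
    have h3 : ∑ q with p < q, f q = ∑ q with p < q, moebiusFn P q :=
      Finset.sum_congr rfl fun q hq => ih q (by simpa using hq)
    linarith

/-! ## The intersect-decompose property -/

section IntersectDecompose

variable {α : Type*} [TopologicalSpace α]

/-- `C` is an irreducible component of the closed subset `Z`. -/
def IsComponentOf (C : IrreducibleCloseds α) (Z : Set α) : Prop :=
  Maximal (fun D : IrreducibleCloseds α => (D : Set α) ⊆ Z) C

/-- All irreducible components of all intersections of members of `P` belong to `P`.  The empty
intersection is the whole space. -/
def IntersectDecompose (P : Set (IrreducibleCloseds α)) : Prop :=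
  ∀ S ⊆ P, ∀ C : IrreducibleCloseds α, IsComponentOf C (⋂ A ∈ S, (A : Set α)) → C ∈ P

/-- The smallest family with the intersect-decompose property. -/
def minimalFamily (α : Type*) [TopologicalSpace α] : Set (IrreducibleCloseds α) :=
  {C | ∀ P : Set (IrreducibleCloseds α), IntersectDecompose P → C ∈ P}

theorem minimalFamily_subset {P : Set (IrreducibleCloseds α)} (hP : IntersectDecompose P) :
    minimalFamily α ⊆ P := fun _ hC => hC P hP

theorem intersectDecompose_minimalFamily : IntersectDecompose (minimalFamily α) :=
  fun S hS C hC P hP => hP S (fun _ hA => hS hA P hP) C hC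

theorem exists_isComponentOf {Z : Set α} (hZ : IsClosed Z) (D : IrreducibleCloseds α)
    (hD : (D : Set α) ⊆ Z) : ∃ C : IrreducibleCloseds α, D ≤ C ∧ IsComponentOf C Z := by
  obtain ⟨C, hDC, hC⟩ := zorn_le_nonempty₀ {s : Set α | IsIrreducible s ∧ s ⊆ Z}
    (fun c hc hch s hs => by
      refine ⟨⋃₀ c, ⟨⟨?_, ?_⟩, ?_⟩, fun t ht => Set.subset_sUnion_of_mem ht⟩
      · obtain ⟨x, hx⟩ := (hc hs).1.1
        exact ⟨x, s, hs, hx⟩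
      · rintro u v hu hv ⟨y, ⟨t, ht, hy⟩, hyu⟩ ⟨z, ⟨t', ht', hz⟩, hzv⟩
        rcases hch.total ht ht' with h | h
        · obtain ⟨w, hw, hw'⟩ := (hc ht').1.2 u v hu hv ⟨y, h hy, hyu⟩ ⟨z, hz, hzv⟩
          exact ⟨w, ⟨t', ht', hw⟩, hw'⟩
        · obtain ⟨w, hw, hw'⟩ := (hc ht).1.2 u v hu hv ⟨y, hy, hyu⟩ ⟨z, h hz, hzv⟩
          exact ⟨w, ⟨t, ht, hw⟩, hw'⟩
      · exact Set.sUnion_subset fun t ht => (hc ht).2)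
    (D : Set α) ⟨D.isIrreducible, hD⟩
  have hcl : IsClosed C := closure_subset_iff_isClosed.mp
    (hC.2 ⟨hC.1.1.closure, closure_minimal hC.1.2 hZ⟩ subset_closure)
  exact ⟨⟨C, hC.1.1, hcl⟩, hDC, hC.1.2, fun E hE hCE => hC.2 ⟨E.isIrreducible, hE⟩ hCE⟩

theorem finite_isComponentOf [NoetherianSpace α] {Z : Set α} (hZ : IsClosed Z) :
    {C : IrreducibleCloseds α | IsComponentOf C Z}.Finite := by
  obtain ⟨S, hS, hcl, hirr, rfl⟩ := NoetherianSpace.exists_finite_set_isClosed_irreducible hZ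
  refine Set.Finite.of_finite_image (f := fun C : IrreducibleCloseds α => (C : Set α))
    (hS.subset ?_) SetLike.coe_injective.injOn
  rintro _ ⟨C, hC, rfl⟩
  lift S to Finset (Set α) using hS
  obtain ⟨t, ht, hCt⟩ := isIrreducible_iff_sUnion_isClosed.1 C.isIrreducible S hcl hC.1
  have h := hC.2 (y := ⟨t, hirr t ht, hcl t ht⟩) (Set.subset_sUnion_of_mem ht) hCt
  have : (C : Set α) = t := Set.Subset.antisymm hCt h
  simpa [this] using ht

theorem exists_finite_pairwise [NoetherianSpace α] (Z : Closeds α) :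
    ∀ F : Set (IrreducibleCloseds α), F.Finite → (∀ A ∈ F, (A : Set α) ⊆ Z) →
      ∃ P : Set (IrreducibleCloseds α), P.Finite ∧ F ⊆ P ∧ (∀ B ∈ P, ∃ A ∈ F, B ≤ A) ∧
        ∀ A ∈ P, ∀ B ∈ P, ∀ C, IsComponentOf C ((A : Set α) ∩ B) → C ∈ P := by
  induction Z using (wellFounded_lt (α := Closeds α)).induction with
  | _ Z ih =>
    intro F hF hFZ
    rcases F.eq_empty_or_nonempty with rfl | hne
    · exact ⟨∅, Set.finite_empty, subset_rfl, by simp, by simp⟩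
    let F' : Set (IrreducibleCloseds α) :=
      ⋃ A ∈ F, ⋃ B ∈ F \ {A}, {C | IsComponentOf C ((A : Set α) ∩ B)}
    have memF' : ∀ {C}, C ∈ F' ↔
        ∃ A ∈ F, ∃ B ∈ F, B ≠ A ∧ IsComponentOf C ((A : Set α) ∩ B) := by
      intro C
      simp only [F', Set.mem_iUnion, Set.mem_sdiff, Set.mem_singleton_iff, Set.mem_ofPred_eq]
      grind
    have hF' : F'.Finite := hF.biUnion fun A _ => (hF.sdiff).biUnion fun B _ =>
      finite_isComponentOf (A.isClosed.inter B.isClosed)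
    have hcl : IsClosed (⋃ C ∈ F', (C : Set α)) := hF'.isClosed_biUnion fun C _ => C.isClosed
    have hlt : (⟨⋃ C ∈ F', (C : Set α), hcl⟩ : Closeds α) < Z := by
      refine lt_of_le_not_ge ?_ ?_
      · refine Set.iUnion₂_subset fun C hC => ?_
        obtain ⟨A, hA, B, hB, -, h⟩ := memF'.1 hC
        exact (h.1.trans Set.inter_subset_left).trans (hFZ A hA)
      · intro hle
        obtain ⟨M, hM⟩ := hF.exists_maximal hne
        have hMZ : (M : Set α) ⊆ ⋃ C ∈ F', (C : Set α) := (hFZ M hM.1).trans hle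
        have hfin : ((fun C : IrreducibleCloseds α => (C : Set α)) '' F').Finite := hF'.image _
        obtain ⟨t, ht, hMt⟩ := isIrreducible_iff_sUnion_isClosed.1 M.isIrreducible hfin.toFinset
          (by simp only [Set.Finite.mem_toFinset]; rintro _ ⟨C, -, rfl⟩; exact C.isClosed)
          (by simpa [Set.sUnion_image] using hMZ)
        obtain ⟨C, hC, rfl⟩ := hfin.mem_toFinset.1 ht
        obtain ⟨A, hA, B, hB, hBA, h⟩ := memF'.1 hC
        have hMA : M ≤ A := hMt.trans (h.1.trans Set.inter_subset_left)
        have hMB : M ≤ B := hMt.trans (h.1.trans Set.inter_subset_right)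
        exact hBA ((hM.eq_of_le hB hMB).symm.trans (hM.eq_of_le hA hMA))
    obtain ⟨P', hP', hF'P', hle', hpair⟩ := ih _ hlt F' hF'
      fun C hC => Set.subset_biUnion_of_mem (u := fun C : IrreducibleCloseds α => (C : Set α)) hC
    have key : ∀ A ∈ F, ∀ B ∈ P', ∀ C, IsComponentOf C ((A : Set α) ∩ B) → C ∈ P' := by
      intro A hA B hB C hC
      obtain ⟨D, hD, hBD⟩ := hle' B hB
      obtain ⟨A₁, hA₁, B₁, hB₁, hne, h⟩ := memF'.1 hD
      by_cases hAA : A₁ = A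
      · subst hAA
        have hBA : (B : Set α) ⊆ A₁ := hBD.trans (h.1.trans Set.inter_subset_left)
        have : C = B := le_antisymm (hC.1.trans Set.inter_subset_right)
          (hC.2 (Set.subset_inter hBA subset_rfl) (hC.1.trans Set.inter_subset_right))
        exact this ▸ hB
      · have hCA : (C : Set α) ⊆ (A : Set α) ∩ A₁ := Set.subset_inter
          (hC.1.trans Set.inter_subset_left) ((hC.1.trans Set.inter_subset_right).trans
            (hBD.trans (h.1.trans Set.inter_subset_left)))
        obtain ⟨E, hCE, hE⟩ := exists_isComponentOf (A.isClosed.inter A₁.isClosed) C hCA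
        have hEP : E ∈ P' := hF'P' (memF'.2 ⟨A, hA, A₁, hA₁, hAA, hE⟩)
        refine hpair E hEP B hB C ⟨Set.subset_inter hCE (hC.1.trans Set.inter_subset_right),
          fun D' hD' hCD' => hC.2 (hD'.trans ?_) hCD'⟩
        exact Set.inter_subset_inter_left _ (hE.1.trans Set.inter_subset_left)
    refine ⟨P' ∪ F, hP'.union hF, Set.subset_union_right, ?_, ?_⟩
    · rintro B (hB | hB)
      · obtain ⟨D, hD, hBD⟩ := hle' B hB
        obtain ⟨A, hA, B₁, -, -, h⟩ := memF'.1 hD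
        exact ⟨A, hA, hBD.trans (h.1.trans Set.inter_subset_left)⟩
      · exact ⟨B, hB, le_rfl⟩
    · rintro A (hA | hA) B (hB | hB) C hC
      · exact Or.inl (hpair A hA B hB C hC)
      · exact Or.inl (key B hB A hA C (by rwa [Set.inter_comm]))
      · exact Or.inl (key A hA B hB C hC)
      · by_cases hBA : B = A
        · subst hBA
          rw [Set.inter_self] at hC
          have : C = B := le_antisymm hC.1 (hC.2 subset_rfl hC.1)
          exact Or.inr (this ▸ hB)
        · exact Or.inl (hF'P' (memF'.2 ⟨A, hA, B, hB, hBA, hC⟩))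

/-- On a Noetherian space the process of intersecting and decomposing stops. -/
theorem finite_minimalFamily [NoetherianSpace α] : (minimalFamily α).Finite := by
  obtain ⟨P, hP, hFP, -, hpair⟩ := exists_finite_pairwise (⊤ : Closeds α)
    {C | IsComponentOf C Set.univ} (finite_isComponentOf isClosed_univ)
    fun A _ => Set.subset_univ _
  refine hP.subset (minimalFamily_subset fun S hSP => ?_)
  have hS : S.Finite := hP.subset hSP
  induction S, hS using Set.Finite.induction_on with
  | empty => intro C hC; exact hFP (by simpa using hC)
  | @insert A S hA hS ih =>
    intro C hC
    rw [Set.biInter_insert] at hC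
    have hcl : IsClosed (⋂ B ∈ S, (B : Set α)) := isClosed_biInter fun B _ => B.isClosed
    obtain ⟨D, hCD, hD⟩ := exists_isComponentOf hcl C (hC.1.trans Set.inter_subset_right)
    refine hpair A (hSP (Set.mem_insert _ _)) D (ih ((Set.subset_insert _ _).trans hSP) D hD) C
      ⟨Set.subset_inter (hC.1.trans Set.inter_subset_left) hCD, fun E hE hCE => hC.2 ?_ hCE⟩
    exact hE.trans (Set.inter_subset_inter_right _ hD.1)

instance [NoetherianSpace α] : Finite (minimalFamily α) := finite_minimalFamily.to_subtype

end IntersectDecompose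

/-! ## Closed subvarieties and their intersections and unions -/

/-- The ideal sheaf of the reduced closed subscheme structure on an irreducible closed subset.
Closed subvarieties of `X` are identified with irreducible closed subsets in this way. -/
def varietyIdeal {X : Scheme.{u}} (A : IrreducibleCloseds X) : X.IdealSheafData :=
  Scheme.IdealSheafData.vanishingIdeal ⟨A, A.isClosed⟩

/-- For all members `A` of the minimal family and all subfamilies `T` of it, the scheme-theoretic
intersection of `A` with the union of the members of `T` is reduced. -/
def HasReducedIntersections (X : Scheme.{u}) : Prop :=
  ∀ A ∈ minimalFamily X, ∀ T ⊆ minimalFamily X,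
    AlgebraicGeometry.IsReduced (varietyIdeal A ⊔ ⨅ B ∈ T, varietyIdeal B).subscheme

/-! ## Coherent sheaves and `K`-homology -/

/-- The structure sheaf, as a module over itself. -/
abbrev structureModule (X : Scheme.{u}) : X.Modules := SheafOfModules.unit X.ringCatSheaf

/-- The pushforward to `X` of the structure sheaf of the closed subscheme with ideal `I`. -/
def closedStructureModule {X : Scheme.{u}} (I : X.IdealSheafData) : X.Modules :=
  (Scheme.Modules.pushforward I.subschemeι).obj (structureModule I.subscheme)

/-- Coherent sheaves on a Noetherian scheme: quasi-coherent sheaves of finite type. -/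
structure IsCoherentModule {X : Scheme.{u}} (F : X.Modules) : Prop where
  isQuasicoherent : SheafOfModules.IsQuasicoherent (R := X.ringCatSheaf) F
  isFiniteType : SheafOfModules.IsFiniteType.{u} (R := X.ringCatSheaf) F

/-- Coherent sheaves on `X`. -/
structure CoherentModule (X : Scheme.{u}) where
  sheaf : X.Modules
  isCoherent : IsCoherentModule sheaf

/-- The relations `[F₂] = [F₁] + [F₃]`, for short exact sequences `0 → F₁ → F₂ → F₃ → 0`. -/
def kRelations (X : Scheme.{u}) : AddSubgroup (FreeAbelianGroup (CoherentModule X)) :=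
  AddSubgroup.closure {r | ∃ (F₁ F₂ F₃ : CoherentModule X) (i : F₁.sheaf ⟶ F₂.sheaf)
    (q : F₂.sheaf ⟶ F₃.sheaf) (w : i ≫ q = 0), (ShortComplex.mk i q w).ShortExact ∧
      r = .of F₂ - .of F₁ - .of F₃}

/-- `K`-homology: the Grothendieck group of coherent sheaves on `X`. -/
abbrev KHomology (X : Scheme.{u}) : Type (u + 1) :=
  FreeAbelianGroup (CoherentModule X) ⧸ kRelations X

/-- The class of a coherent sheaf. -/
def kClass {X : Scheme.{u}} (F : X.Modules) (hF : IsCoherentModule F) : KHomology X :=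
  QuotientAddGroup.mk (FreeAbelianGroup.of ⟨F, hF⟩)

/-! ## Pullback of the structure sheaf -/

/-- The comorphism `𝒪_X → f_* 𝒪_Y` of a morphism `f : Y → X`. -/
def comorphism {Y X : Scheme.{u}} (f : Y ⟶ X) :
    structureModule X ⟶ (Scheme.Modules.pushforward f).obj (structureModule Y) :=
  SheafOfModules.unitToPushforwardObjUnit f.toRingCatSheafHom

/-- The canonical map `f^* 𝒪_X → 𝒪_Y`. -/
def pullbackStructure {Y X : Scheme.{u}} (f : Y ⟶ X) :
    (Scheme.Modules.pullback f).obj (structureModule X) ⟶ structureModule Y :=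
  ((Scheme.Modules.pullbackPushforwardAdjunction f).homEquiv _ _).symm (comorphism f)

theorem final_opensMap {Y X : Scheme.{u}} (f : Y ⟶ X) : (Opens.map f.base).Final := by
  have h : Limits.IsTerminal ((Opens.map f.base).obj (⊤_ X.Opens)) := by
    have : (⊤_ X.Opens) = ⊤ := top_le_iff.mp (leOfHom (Limits.terminal.from _))
    rw [this]
    exact Limits.IsTerminal.ofUniqueHom (fun U => homOfLE le_top) (fun _ _ => Subsingleton.elim _ _)
  have : Limits.PreservesLimit (Functor.empty.{0} X.Opens) (Opens.map f.base) :=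
    Limits.preservesTerminal_of_iso _ (h.uniqueUpToIso Limits.terminalIsTerminal)
  infer_instance

instance {Y X : Scheme.{u}} (f : Y ⟶ X) : IsIso (pullbackStructure f) := by
  have := final_opensMap f
  have h : (SheafOfModules.pushforward.{u} f.toRingCatSheafHom).IsRightAdjoint :=
    inferInstanceAs (Scheme.Modules.pushforward f).IsRightAdjoint
  have := @SheafOfModules.instIsIsoPullbackObjUnitToUnitOfFinal _ _ _ _ _ _
    (Opens.map f.base) _ _ _ f.toRingCatSheafHom h this
  exact this

/-! ## Group actions and equivariant sheaves -/

section Equivariant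

variable {S : Scheme.{u}} (G : Over S) [GrpObj G] {X : Scheme.{u}} (s : X ⟶ S)

/-- The product `G ×_S X`. -/
abbrev actSource : Scheme.{u} := (G ⊗ Over.mk s).left

/-- The product `G ×_S (G ×_S X)`. -/
abbrev actSource₂ : Scheme.{u} := (G ⊗ (G ⊗ Over.mk s)).left

/-- The projection `(g, x) ↦ x`. -/
def projMap : actSource G s ⟶ X := (snd G (Over.mk s)).left

/-- The map `(g, h, x) ↦ (h, x)`. -/
def projMap₂ : actSource₂ G s ⟶ actSource G s := (snd G (G ⊗ Over.mk s)).left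

/-- The map `(g, h, x) ↦ (g h, x)`. -/
def mulMap₂ : actSource₂ G s ⟶ actSource G s :=
  ((α_ G G (Over.mk s)).inv ≫ MonObj.mul ▷ Over.mk s).left

theorem mulMap₂_projMap : mulMap₂ G s ≫ projMap G s = projMap₂ G s ≫ projMap G s := by
  have h : ((α_ G G (Over.mk s)).inv ≫ MonObj.mul ▷ Over.mk s) ≫ snd G (Over.mk s) =
      snd G (G ⊗ Over.mk s) ≫ snd G (Over.mk s) := by
    simp
  exact congrArg CommaMorphism.left h

variable [ModObj G (Over.mk s)]

/-- The action `G ×_S X → X`, as a morphism over `S`. -/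
abbrev overAct : G ⊗ Over.mk s ⟶ Over.mk s := ModObj.smul (M := G) (X := Over.mk s)

/-- The action `(g, x) ↦ g x`. -/
def actMap : actSource G s ⟶ X := (overAct G s).left

/-- The map `(g, h, x) ↦ (g, h x)`. -/
def actMap₂ : actSource₂ G s ⟶ actSource G s := (G ◁ overAct G s).left

theorem projMap₂_actMap : projMap₂ G s ≫ actMap G s = actMap₂ G s ≫ projMap G s := by
  have h : snd G (G ⊗ Over.mk s) ≫ overAct G s = (G ◁ overAct G s) ≫ snd G (Over.mk s) := by
    simp
  exact congrArg CommaMorphism.left h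

theorem actMap₂_actMap : actMap₂ G s ≫ actMap G s = mulMap₂ G s ≫ actMap G s := by
  have h : (G ◁ overAct G s) ≫ overAct G s =
      ((α_ G G (Over.mk s)).inv ≫ MonObj.mul ▷ Over.mk s) ≫ overAct G s := by
    rw [Category.assoc]
    exact ModObj.mul_smul_self_flip (M := G) (Over.mk s)
  exact congrArg CommaMorphism.left h

/-- `G` preserves the closed subscheme `Z` with ideal `I`: the action restricts to a map
`G ×_S Z → Z`. -/
def Preserves (I : X.IdealSheafData) : Prop :=
  ∃ b : G ⊗ Over.mk (I.subschemeι ≫ s) ⟶ Over.mk (I.subschemeι ≫ s),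
    b ≫ (Over.homMk I.subschemeι : Over.mk (I.subschemeι ≫ s) ⟶ Over.mk s) =
      G ◁ (Over.homMk I.subschemeι : Over.mk (I.subschemeι ≫ s) ⟶ Over.mk s) ≫ overAct G s

variable {G s}

/-- The pullback along `t` of a morphism `p^* F → a^* F`, as a morphism
`(p t)^* F → (a t)^* F`. -/
def pullbackHom {T Y : Scheme.{u}} {p a : Y ⟶ X} {F : X.Modules}
    (φ : (Scheme.Modules.pullback p).obj F ⟶ (Scheme.Modules.pullback a).obj F) (t : T ⟶ Y) :
    (Scheme.Modules.pullback (t ≫ p)).obj F ⟶ (Scheme.Modules.pullback (t ≫ a)).obj F :=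
  (Scheme.Modules.pullbackComp t p).inv.app F ≫ (Scheme.Modules.pullback t).map φ ≫
    (Scheme.Modules.pullbackComp t a).hom.app F

variable (G s)

/-- A `G`-equivariant structure on `F`: an isomorphism `p^* F ≅ a^* F` on `G ×_S X`, with fibres
`φ_{g, x} : F_x ≅ F_{g x}`, that satisfies the cocycle condition
`φ_{g h, x} = φ_{g, h x} ∘ φ_{h, x}` on `G ×_S G ×_S X`. -/
structure EquivariantStructure (F : X.Modules) where
  iso : (Scheme.Modules.pullback (projMap G s)).obj F ≅
    (Scheme.Modules.pullback (actMap G s)).obj F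
  cocycle : pullbackHom iso.hom (mulMap₂ G s) =
    (Scheme.Modules.pullbackCongr (mulMap₂_projMap G s)).hom.app F ≫
      pullbackHom iso.hom (projMap₂ G s) ≫
      (Scheme.Modules.pullbackCongr (projMap₂_actMap G s)).hom.app F ≫
      pullbackHom iso.hom (actMap₂ G s) ≫
      (Scheme.Modules.pullbackCongr (actMap₂_actMap G s)).hom.app F

/-- The canonical isomorphism `p^* 𝒪_X ≅ 𝒪_{G × X} ≅ a^* 𝒪_X`. -/
def structureIso : (Scheme.Modules.pullback (projMap G s)).obj (structureModule X) ≅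
    (Scheme.Modules.pullback (actMap G s)).obj (structureModule X) :=
  asIso (pullbackStructure (projMap G s)) ≪≫ (asIso (pullbackStructure (actMap G s))).symm

variable {G s}

/-- The map `π : 𝒪_X → F` is `G`-equivariant, for the canonical equivariant structure of `𝒪_X`.
When `π` is an epimorphism, this determines the equivariant structure of `F`. -/
def EquivariantStructure.IsCanonical {F : X.Modules} (φ : EquivariantStructure G s F)
    (π : structureModule X ⟶ F) : Prop :=
  (Scheme.Modules.pullback (projMap G s)).map π ≫ φ.iso.hom =
    (structureIso G s).hom ≫ (Scheme.Modules.pullback (actMap G s)).map π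

variable (G s)

/-- `G`-equivariant coherent sheaves on `X`. -/
structure EquivariantCoherentModule where
  sheaf : X.Modules
  isCoherent : IsCoherentModule sheaf
  equivariant : EquivariantStructure G s sheaf

variable {G s}

/-- A morphism of sheaves that commutes with the equivariant structures. -/
def IsEquivariantHom {E F : EquivariantCoherentModule G s} (f : E.sheaf ⟶ F.sheaf) : Prop :=
  (Scheme.Modules.pullback (projMap G s)).map f ≫ F.equivariant.iso.hom =
    E.equivariant.iso.hom ≫ (Scheme.Modules.pullback (actMap G s)).map f

variable (G s)

/-- The relations `[F₂] = [F₁] + [F₃]`, for short exact sequences `0 → F₁ → F₂ → F₃ → 0` of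
equivariant coherent sheaves. -/
def equivariantKRelations :
    AddSubgroup (FreeAbelianGroup (EquivariantCoherentModule G s)) :=
  AddSubgroup.closure {r | ∃ (F₁ F₂ F₃ : EquivariantCoherentModule G s)
    (i : F₁.sheaf ⟶ F₂.sheaf) (q : F₂.sheaf ⟶ F₃.sheaf) (w : i ≫ q = 0),
      IsEquivariantHom i ∧ IsEquivariantHom q ∧ (ShortComplex.mk i q w).ShortExact ∧
        r = .of F₂ - .of F₁ - .of F₃}

/-- Equivariant `K`-homology: the Grothendieck group of equivariant coherent sheaves on `X`. -/
abbrev EquivariantKHomology : Type (u + 1) :=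
  FreeAbelianGroup (EquivariantCoherentModule G s) ⧸ equivariantKRelations G s

variable {G s}

/-- The class of an equivariant coherent sheaf. -/
def equivariantKClass {F : X.Modules} (hF : IsCoherentModule F)
    (φ : EquivariantStructure G s F) : EquivariantKHomology G s :=
  QuotientAddGroup.mk (FreeAbelianGroup.of ⟨F, hF, φ⟩)

end Equivariant

end

/-!
Write `I_D` for the ideal sheaf of the union of the members of an order ideal `D` of the minimal
family `P_X`. Intersecting and decomposing shows that the union of `D` meets a member `A` in the
union of `D ⊓ Iic A`, and the hypothesis on reduced intersections says that this holds for ideals: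
`I_D + I_A = I_{D ⊓ Iic A}` (`HasReducedIntersections.unionIdeal_inf_Iic`), while always
`I_D ∩ I_A = I_{D ⊔ Iic A}`. The Mayer–Vietoris sequence
`0 → 𝒪/(I ∩ J) → 𝒪/I ⊕ 𝒪/J → 𝒪/(I + J) → 0` (`IsQuotientBy.shortExact`) thus makes
`D ↦ [𝒪_X/I_D]` a valuation on the order ideals, and a valuation on the order ideals of a finite
poset is evaluated at the top by the Möbius function (`eq_sum_moebiusFn_of_valuation`). Since `X`
is reduced, the top order ideal has ideal `0`. A larger family with the intersect-decompose
property has the same Möbius function, extended by zero, because every irreducible closed set has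
a least member of `P_X` above it (`moebiusFn_eq_extend_minimalFamily`).

The computation is made in equivariant `K`-homology; the formula in `K`-homology is the case of the
trivial group. Write `p` and `a` for the projection and the action `G × X → X`. A preserved ideal
sheaf satisfies `p⁻¹ I = a⁻¹ I` (`comap_actMap_eq_of_preserves`), by the shear automorphism of
`G × X`, and flatness of `p` and `a` gives the same for finite intersections. Every sheaf in the
argument is generated by finitely many maps from `𝒪_X`, and `p^* 𝒪_X ≅ 𝒪 ≅ a^* 𝒪_X` descends
to the quotient by an invariant ideal sheaf (`IsQuotientBy.exists_pullback_hom`). Invertibility,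
the cocycle condition and the equivariance of morphisms can all be checked on the generators, where
they follow from the case of `𝒪_X` (`Generates.exists_equivariantStructure`,
`Generates.isEquivariantHom`).

For a connected group scheme `G` locally of finite type over a field, the members of `P_X` that `G`
preserves have the intersect-decompose property. An intersection `Z` of preserved members is
preserved with its reduced structure, which is the scheme-theoretic one by hypothesis. As `G` is
geometrically irreducible (`geometricallyIrreducible_of_grpObj`), the preimage of a component `C`
of `Z` under `p` is irreducible, so its image under `a` lies in a component, which is `C` because
of the unit. That the reduced structure of `C` is preserved as a scheme, although `G` need not be
reduced, follows from flatness: a function vanishing on the other components but not on `C` is a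
nonzerodivisor modulo the ideal of `p⁻¹ C` (`comap_varietyIdeal_le`).
-/

noncomputable section

/-! ### Möbius functions -/

/-- Inserting points that have a least upper bound among the old ones does not change a Möbius
function: the old points keep their values and the new ones get the value `0`. -/
theorem moebiusFn_eq_extend {P Q : Type*} [PartialOrder P] [PartialOrder Q] [Fintype P] [Finite Q]
    (e : Q ↪o P) (he : ∀ p : P, ∃ q : Q, p ≤ e q ∧ ∀ q', p ≤ e q' → q ≤ q') :
    moebiusFn P = Function.extend e (moebiusFn Q) 0 := by
  classical
  have := Fintype.ofFinite Q
  refine (eq_moebiusFn P _ fun p => ?_).symm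
  obtain ⟨q, hpq, hq⟩ := he p
  rw [← sum_moebiusFn Q q]
  symm
  refine Finset.sum_of_injOn e e.injective.injOn (fun r hr => ?_) (fun r hr hr' => ?_)
    fun r hr => (e.injective.extend_apply _ _ r).symm
  · simp only [Finset.coe_filter, Finset.mem_univ, true_and, Set.mem_ofPred_eq] at hr ⊢
    exact hpq.trans (e.monotone hr)
  · refine Function.extend_apply' _ _ _ ?_
    rintro ⟨a, rfl⟩
    refine hr' ⟨a, ?_, rfl⟩
    simpa using hq a (by simpa using hr)

/-- Möbius inversion for a valuation `c` on the lower sets of a finite poset: the value on the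
whole poset is a combination of the values on principal lower sets, with the Möbius function as
coefficients. -/
theorem eq_sum_moebiusFn_of_valuation {Q M : Type*} [PartialOrder Q] [Fintype Q] [AddCommGroup M]
    (c : LowerSet Q → M) (hbot : c ⊥ = 0)
    (hc : ∀ (D : LowerSet Q) (a : Q),
      c (D ⊔ LowerSet.Iic a) + c (D ⊓ LowerSet.Iic a) = c D + c (LowerSet.Iic a)) :
    c ⊤ = ∑ a, moebiusFn Q a • c (LowerSet.Iic a) := by
  classical
  -- Each lower set has its own Möbius function; these satisfy the same valuation property.
  have key : ∀ D : LowerSet Q, ∃ f : Q → ℤ, (∀ p, ∑ q with p ≤ q, f q = if p ∈ D then 1 else 0) ∧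
      c D = ∑ a, f a • c (LowerSet.Iic a) := by
    intro D
    induction D using (wellFounded_lt (α := LowerSet Q)).induction with
    | _ D ih =>
      by_cases hD : D = ⊥
      · subst hD
        exact ⟨0, by simp, by simp [hbot]⟩
      have hne : (D : Set Q).Nonempty := by
        rw [Set.nonempty_iff_ne_empty]
        exact fun h => hD (SetLike.coe_injective h)
      obtain ⟨a, ha⟩ := (Set.toFinite (D : Set Q)).exists_maximal hne
      have haD : a ∈ D := ha.1
      have hsup : D.erase a ⊔ LowerSet.Iic a = D :=
        LowerSet.erase_sup_Iic haD fun b hb hab => le_antisymm (ha.2 hb hab) hab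
      have hlt : D.erase a < D := LowerSet.erase_lt.2 haD
      obtain ⟨f, hf, hcf⟩ := ih _ hlt
      obtain ⟨g, hg, hcg⟩ := ih (D.erase a ⊓ LowerSet.Iic a) (inf_le_left.trans_lt hlt)
      refine ⟨f + Pi.single a 1 - g, fun p => ?_, ?_⟩
      · have h1 : ∑ q with p ≤ q, (Pi.single a 1 : Q → ℤ) q = if p ≤ a then 1 else 0 := by
          rw [Finset.sum_filter]
          simp_rw [Pi.single_apply, ← ite_and]
          rw [Finset.sum_eq_single a] <;> aesop
        have h2 : p ∈ D ↔ p ∈ D.erase a ∨ p ≤ a := by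
          conv_lhs => rw [← hsup]
          simp
        simp only [Pi.sub_apply, Pi.add_apply, Finset.sum_sub_distrib, Finset.sum_add_distrib,
          hf, hg, h1, LowerSet.mem_inf_iff, LowerSet.mem_Iic_iff, h2]
        by_cases h3 : p ∈ D.erase a <;> by_cases h4 : p ≤ a <;> simp [h3, h4]
      · have h := hc (D.erase a) a
        rw [hsup, hcf, hcg] at h
        rw [eq_sub_of_add_eq h]
        simp only [Pi.sub_apply, Pi.add_apply, sub_smul, add_smul, Finset.sum_sub_distrib,
          Finset.sum_add_distrib]
        congr 2
        rw [Finset.sum_eq_single a] <;> simp +contextual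
  obtain ⟨f, hf, hcf⟩ := key ⊤
  rwa [eq_moebiusFn Q f (by simpa using hf)] at hcf

section IntersectDecompose

variable {α : Type*} [TopologicalSpace α]

theorem coe_eq_biUnion_isComponentOf (Z : Closeds α) :
    (Z : Set α) = ⋃ C ∈ {C : IrreducibleCloseds α | IsComponentOf C Z}, (C : Set α) := by
  refine Set.Subset.antisymm (fun x hx => ?_) (Set.iUnion₂_subset fun C hC => hC.1)
  obtain ⟨C, hxC, hC⟩ := exists_isComponentOf Z.isClosed
    ⟨closure {x}, isIrreducible_singleton.closure, isClosed_closure⟩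
    (closure_minimal (Set.singleton_subset_iff.2 hx) Z.isClosed)
  exact Set.mem_biUnion hC (hxC (subset_closure rfl))

/-- Every irreducible closed set has a hull in the minimal family: the component containing it
of the intersection of all members that contain it. -/
theorem exists_least_mem_minimalFamily (A : IrreducibleCloseds α) :
    ∃ C ∈ minimalFamily α, A ≤ C ∧ ∀ B ∈ minimalFamily α, A ≤ B → C ≤ B := by
  obtain ⟨C, hAC, hC⟩ := exists_isComponentOf
    (Z := ⋂ B ∈ {B | B ∈ minimalFamily α ∧ A ≤ B}, (B : Set α))
    (isClosed_biInter fun B _ => B.isClosed) A (Set.subset_iInter₂ fun B hB => hB.2)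
  exact ⟨C, intersectDecompose_minimalFamily _ (fun B hB => hB.1) C hC, hAC,
    fun B hB hAB => hC.1.trans (Set.biInter_subset_of_mem (show B ∈ {B | _ ∧ _} from ⟨hB, hAB⟩))⟩

/-- A larger family with the intersect-decompose property has the Möbius function of the minimal
family, extended by zero. -/
theorem moebiusFn_eq_extend_minimalFamily [NoetherianSpace α]
    {P : Finset (IrreducibleCloseds α)}
    (hP : IntersectDecompose (P : Set (IrreducibleCloseds α))) :
    moebiusFn P = Function.extend
      (fun A : minimalFamily α => (⟨A.1, minimalFamily_subset hP A.2⟩ : P))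
      (moebiusFn (minimalFamily α)) 0 := by
  refine moebiusFn_eq_extend
    (e := { toFun := fun A : minimalFamily α => (⟨A.1, minimalFamily_subset hP A.2⟩ : P)
            inj' := fun A B h => Subtype.ext (congrArg (fun A : P => A.1) h)
            map_rel_iff' := Iff.rfl }) fun p => ?_
  obtain ⟨C, hC, hpC, hmin⟩ := exists_least_mem_minimalFamily p.1
  exact ⟨⟨C, hC⟩, hpC, fun B hB => hmin B.1 B.2 hB⟩

end IntersectDecompose
end

noncomputable section

/-! ### Connected group schemes are geometrically irreducible -/

section Topology

variable {X Y : Type*} [TopologicalSpace X] [TopologicalSpace Y]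

theorem preconnectedSpace_of_isOpenMap_of_isClosedMap {f : Y → X} [PreconnectedSpace X]
    (ho : IsOpenMap f) (hc : IsClosedMap f) {x : X} (hx : (f ⁻¹' {x}).Subsingleton) :
    PreconnectedSpace Y := by
  rw [preconnectedSpace_iff_clopen]
  intro s hs
  by_contra! h
  have key : ∀ t : Set Y, IsClopen t → t.Nonempty → ∃ y ∈ t, f y = x := by
    intro t ht hne
    have h : x ∈ f '' t := by
      rw [IsClopen.eq_univ ⟨hc _ ht.1, ho _ ht.2⟩ (hne.image f)]
      trivial
    exact h
  obtain ⟨y, hy, hyx⟩ := key s hs h.1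
  obtain ⟨z, hz, hzx⟩ := key sᶜ hs.compl (Set.nonempty_compl.2 h.2)
  exact hz (hx (show y ∈ f ⁻¹' {x} from hyx) hzx ▸ hy)

theorem preconnectedSpace_of_isOpenMap_of_dense {f : Y → X} [PreconnectedSpace X]
    (ho : IsOpenMap f) (hf : Function.Surjective f)
    (hx : Dense {x | (f ⁻¹' {x}).Subsingleton}) : PreconnectedSpace Y := by
  rw [preconnectedSpace_iff_clopen]
  intro s hs
  by_contra! h
  obtain ⟨x, -, hx1, hx2⟩ := isPreconnected_univ (f '' s) (f '' sᶜ) (ho _ hs.2)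
    (ho _ hs.compl.2) (by
      intro x _
      obtain ⟨y, rfl⟩ := hf x
      by_cases hy : y ∈ s
      · exact Or.inl ⟨y, hy, rfl⟩
      · exact Or.inr ⟨y, hy, rfl⟩)
    (by simpa using h.1) (by simpa using Set.nonempty_compl.2 h.2)
  obtain ⟨x, ⟨⟨y, hy, hyx⟩, ⟨z, hz, hzx⟩⟩, hxs⟩ := hx.inter_open_nonempty _
    ((ho _ hs.2).inter (ho _ hs.compl.2)) ⟨x, hx1, hx2⟩
  exact hz (hxs (show y ∈ f ⁻¹' {x} from hyx) hzx ▸ hy)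

/-- A connected space that is locally irreducible is irreducible, since every irreducible component
is open. -/
theorem irreducibleSpace_of_forall_exists_isIrreducible [ConnectedSpace X]
    (h : ∀ x : X, ∃ U : Set X, IsOpen U ∧ x ∈ U ∧ IsIrreducible U) : IrreducibleSpace X := by
  obtain ⟨x⟩ : Nonempty X := inferInstance
  have hZ : IsOpen (irreducibleComponent x) := by
    rw [isOpen_iff_forall_mem_open]
    intro z hz
    obtain ⟨U, hU, hzU, hirr⟩ := h z
    refine ⟨U, ?_, hU, hzU⟩
    have h1 : irreducibleComponent x ⊆ closure U :=
      (subset_closure_inter_of_isPreirreducible_of_isOpen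
        isIrreducible_irreducibleComponent.isPreirreducible hU ⟨z, hz, hzU⟩).trans
        (closure_mono Set.inter_subset_right)
    exact subset_closure.trans (eq_irreducibleComponent hirr.closure.isPreirreducible h1).subset
  have huniv := IsClopen.eq_univ ⟨isClosed_irreducibleComponent, hZ⟩ ⟨x, mem_irreducibleComponent⟩
  rw [irreducibleSpace_def, Set.top_eq_univ, ← huniv]
  exact isIrreducible_irreducibleComponent

theorem exists_isOpen_isIrreducible [NoetherianSpace X] [Nonempty X] :
    ∃ U : Set X, IsOpen U ∧ IsIrreducible U := by
  obtain ⟨x⟩ : Nonempty X := inferInstance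
  obtain ⟨U, hU, hne, hUs⟩ := NoetherianSpace.exists_isOpen_nonempty_subset_irreducibleComponent
    (irreducibleComponent x) (irreducibleComponent_mem_irreducibleComponents x)
  exact ⟨U, hU, hne,
    isIrreducible_irreducibleComponent.isPreirreducible.open_subset hU hUs⟩

end Topology

section Geometric

open Limits

variable {k K : Type u} [Field k] [Field K]

/-- The fibre of a base change of fields over a rational point is a single point. -/
theorem subsingleton_preimage_pullback_fst {G : Scheme.{u}} (f : G ⟶ Spec (.of k))
    (g : Spec (.of K) ⟶ Spec (.of k)) (e : Spec (.of k) ⟶ G) (he : e ≫ f = 𝟙 _)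
    (x : Spec (.of k)) : (pullback.fst f g ⁻¹' {e x}).Subsingleton := by
  let s : Spec (.of K) ⟶ pullback f g := pullback.lift (g ≫ e) (𝟙 _) (by simp [he])
  have h1 : IsPullback (s ≫ pullback.snd f g) g g (e ≫ f) := by
    have h : s ≫ pullback.snd f g = 𝟙 _ := pullback.lift_snd _ _ _
    rw [h, he]
    exact .of_id_fst
  have h2 : IsPullback s g (pullback.fst f g) e :=
    h1.of_right (pullback.lift_fst _ _ _) (IsPullback.of_hasPullback f g).flip
  have h3 : Set.range s = pullback.fst f g ⁻¹' Set.range e := by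
    rw [← Scheme.Pullback.range_fst, ← h2.isoPullback_hom_fst, Scheme.Hom.comp_base,
      TopCat.coe_comp, Set.range_comp, Set.range_eq_univ.2 h2.isoPullback.hom.surjective,
      Set.image_univ]
  have h4 : (Set.range s).Subsingleton := Set.subsingleton_range _
  rw [h3] at h4
  exact h4.anti (Set.preimage_mono (by rintro _ rfl; exact ⟨x, rfl⟩))

/-- A connected scheme over a field with a rational point stays connected over the algebraic
closure: the base change is open and closed, and its fibre over the rational point is a point. -/
theorem preconnectedSpace_pullback_algebraicClosure {G : Scheme.{u}} (f : G ⟶ Spec (.of k))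
    [PreconnectedSpace G] (e : Spec (.of k) ⟶ G) (he : e ≫ f = 𝟙 _) :
    PreconnectedSpace ↥(pullback f
      (Spec.map (CommRingCat.ofHom (algebraMap k (AlgebraicClosure k))))) := by
  have : IsIntegralHom (Spec.map (CommRingCat.ofHom (algebraMap k (AlgebraicClosure k)))) := by
    rw [IsIntegralHom.SpecMap_iff]
    exact algebraMap_isIntegral_iff.2 inferInstance
  exact preconnectedSpace_of_isOpenMap_of_isClosedMap
    (Scheme.Hom.isOpenMap (pullback.fst _ _)) (Scheme.Hom.isClosedMap (pullback.fst _ _))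
    (subsingleton_preimage_pullback_fst f _ e he (IsLocalRing.closedPoint k))

/-- Over an algebraically closed field, connectedness is stable under extension of the field:
the closed points are rational, and they are dense. -/
theorem preconnectedSpace_pullback_of_isAlgClosed [IsAlgClosed k] {G : Scheme.{u}}
    (f : G ⟶ Spec (.of k)) [LocallyOfFiniteType f] [PreconnectedSpace G]
    (g : Spec (.of K) ⟶ Spec (.of k)) : PreconnectedSpace ↥(pullback f g) := by
  have : JacobsonSpace G := LocallyOfFiniteType.jacobsonSpace f
  have : Surjective g := ⟨Function.surjective_to_subsingleton (β := Spec (.of k)) _⟩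
  refine preconnectedSpace_of_isOpenMap_of_dense (Scheme.Hom.isOpenMap (pullback.fst f g))
    (pullback.fst f g).surjective ?_
  rw [dense_iff_inter_open]
  intro U hU hne
  obtain ⟨x, hxU, hx⟩ := nonempty_inter_closedPoints hne hU.isLocallyClosed
  replace hx : IsClosed {x} := hx
  refine ⟨x, hxU, ?_⟩
  obtain ⟨a⟩ : Nonempty (Spec (.of k)) := inferInstance
  have h := subsingleton_preimage_pullback_fst f g (pointOfClosedPoint f x hx)
    (pointOfClosedPoint_comp f x hx) a
  rw [pointOfClosedPoint_apply f x hx] at h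
  exact h

open MonObj in
/-- Over an algebraically closed field, translations carry any closed point of a group scheme to
any other, so if one point has an irreducible neighbourhood then all do. -/
theorem irreducibleSpace_of_grpObj_of_isAlgClosed [IsAlgClosed k] {G : Scheme.{u}}
    (f : G ⟶ Spec (.of k)) [LocallyOfFiniteType f] [GrpObj (Over.mk f)] [ConnectedSpace G] :
    IrreducibleSpace G := by
  have : JacobsonSpace G := LocallyOfFiniteType.jacobsonSpace f
  have : IsLocallyNoetherian G := LocallyOfFiniteType.isLocallyNoetherian f
  obtain ⟨U, hU, hirr⟩ : ∃ U : Set G, IsOpen U ∧ IsIrreducible U := by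
    obtain ⟨x⟩ : Nonempty G := inferInstance
    obtain ⟨_, ⟨V, hV, rfl⟩, hxV, -⟩ :=
      G.isBasis_affineOpens.exists_subset_of_mem_open (Set.mem_univ x) isOpen_univ
    have : NoetherianSpace V := by
      have := IsLocallyNoetherian.component_noetherian (X := G) ⟨V, hV⟩
      exact noetherianSpace_of_isAffineOpen V hV
    have : Nonempty V := ⟨⟨x, hxV⟩⟩
    obtain ⟨W, hW, hWirr⟩ := exists_isOpen_isIrreducible (X := V)
    exact ⟨Subtype.val '' W, V.2.isOpenMap_subtype_val _ hW,
      hWirr.image _ continuous_subtype_val.continuousOn⟩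
  refine irreducibleSpace_of_forall_exists_isIrreducible fun x => ?_
  by_contra hx
  obtain ⟨y, hyU, hy⟩ := nonempty_inter_closedPoints hirr.nonempty hU.isLocallyClosed
  obtain ⟨z, hz, hzc⟩ := nonempty_inter_closedPoints
    (Z := {x : G | ∃ U : Set G, IsOpen U ∧ x ∈ U ∧ IsIrreducible U}ᶜ) ⟨x, hx⟩
    (by
      refine IsClosed.isLocallyClosed (isClosed_compl_iff.2 ?_)
      rw [isOpen_iff_forall_mem_open]
      rintro w ⟨W, hW, hw, hWirr⟩
      exact ⟨W, fun v hv => ⟨W, hW, hv, hWirr⟩, hW, hw⟩)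
  refine hz ?_
  let z' : 𝟙_ _ ⟶ Over.mk f := Over.homMk _ ((pointEquivClosedPoint f).symm ⟨z, hzc⟩).2
  let y' : 𝟙_ _ ⟶ Over.mk f := Over.homMk _ ((pointEquivClosedPoint f).symm ⟨y, hy⟩).2
  let α := (GrpObj.mulRight (A := Over.mk f) y').symm ≪≫ (GrpObj.mulRight (A := Over.mk f) z')
  have hα : y' ≫ α.hom = z' := by
    dsimp only [Iso.trans_hom, Iso.symm_hom, α]
    rw [← Category.assoc, ← Iso.eq_comp_inv]
    simp [comp_lift_assoc]
  have hα' : α.hom.left y = z := by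
    obtain ⟨a⟩ : Nonempty (𝟙_ (Over (Spec (.of k)))).left :=
      inferInstanceAs (Nonempty (Spec (.of k)))
    have h : α.hom.left (y'.left a) = z'.left a := congr(($hα).left a)
    have hy' : y'.left a = y := pointOfClosedPoint_apply f y hy _
    have hz' : z'.left a = z := pointOfClosedPoint_apply f z hzc _
    rwa [hy', hz'] at h
  exact ⟨α.hom.left '' U, ((Over.forget _).mapIso α).hom.homeomorph.isOpenMap U hU, ⟨y, hyU, hα'⟩,
    hirr.image _ α.hom.left.continuous.continuousOn⟩

/-- A connected group scheme locally of finite type over a field is geometrically irreducible. -/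
theorem geometricallyIrreducible_of_grpObj {G : Scheme.{u}} (f : G ⟶ Spec (.of k))
    [LocallyOfFiniteType f] [GrpObj (Over.mk f)] [ConnectedSpace G] :
    GeometricallyIrreducible f := by
  refine ⟨geometrically_iff_of_commRing_of_isClosedUnderIsomorphisms.2 fun K _ _ => ?_⟩
  let L := AlgebraicClosure K
  let a : AlgebraicClosure k →ₐ[k] L := IsAlgClosed.lift
  let g : Spec (.of K) ⟶ Spec (.of k) := Spec.map (CommRingCat.ofHom (algebraMap k K))
  let h : Spec (.of L) ⟶ Spec (.of K) := Spec.map (CommRingCat.ofHom (algebraMap K L))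
  let i : Spec (.of (AlgebraicClosure k)) ⟶ Spec (.of k) :=
    Spec.map (CommRingCat.ofHom (algebraMap k (AlgebraicClosure k)))
  let j : Spec (.of L) ⟶ Spec (.of (AlgebraicClosure k)) :=
    Spec.map (CommRingCat.ofHom a.toRingHom)
  have hij : h ≫ g = j ≫ i := by
    simp only [h, g, i, j, ← Spec.map_comp, ← CommRingCat.ofHom_comp]
    congr 2
    exact (IsScalarTower.algebraMap_eq k K L).symm.trans a.comp_algebraMap.symm
  have : ConnectedSpace ↥(pullback f i) :=
    { toPreconnectedSpace := preconnectedSpace_pullback_algebraicClosure f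
        (MonObj.one (X := Over.mk f)).left (Over.w (MonObj.one (X := Over.mk f)))
      toNonempty := by
        have : Surjective i := ⟨Function.surjective_to_subsingleton (β := Spec (.of k)) _⟩
        obtain ⟨x⟩ : Nonempty G := inferInstance
        exact ⟨((pullback.fst f i).surjective x).choose⟩ }
  have : ConnectedSpace ↥(pullback f (h ≫ g)) := by
    rw [hij]
    let e := pullbackLeftPullbackSndIso f i j
    have h1 : PreconnectedSpace ↥(pullback (pullback.snd f i) j) :=
      preconnectedSpace_pullback_of_isAlgClosed _ _
    have : Surjective j :=
      ⟨Function.surjective_to_subsingleton (β := Spec (.of (AlgebraicClosure k))) _⟩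
    have h2 : Nonempty ↥(pullback (pullback.snd f i) j) := by
      obtain ⟨x⟩ : Nonempty ↥(pullback f i) := inferInstance
      exact ⟨((pullback.fst (pullback.snd f i) j).surjective x).choose⟩
    have : ConnectedSpace ↥(pullback (pullback.snd f i) j) := ⟨h2⟩
    exact e.hom.surjective.connectedSpace e.hom.continuous
  let : GrpObj (Over.mk (pullback.snd f (h ≫ g))) := Over.grpObjMkPullbackSnd
  have := irreducibleSpace_of_grpObj_of_isAlgClosed (pullback.snd f (h ≫ g))
  have : Surjective h := ⟨Function.surjective_to_subsingleton (β := Spec (.of K)) _⟩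
  let q : pullback f (h ≫ g) ⟶ pullback f g :=
    (pullbackLeftPullbackSndIso f g h).inv ≫ pullback.fst (pullback.snd f g) h
  have hq : Function.Surjective q := q.surjective
  rw [irreducibleSpace_def, Set.top_eq_univ, ← Set.image_univ_of_surjective hq]
  exact (IrreducibleSpace.isIrreducible_univ _).image _ q.continuous.continuousOn

end Geometric
end

noncomputable section

/-! ### Extension of ideals along flat ring homomorphisms -/

section FlatRing

variable {A B : Type*} [CommRing A] [CommRing B] {f : A →+* B}

/-- Elements of an extended ideal, with generators indexed by `Fin n` for the equational criterion
of flatness. -/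
theorem Ideal.exists_sum_of_mem_map {I : Ideal A} {x : B} (hx : x ∈ I.map f) :
    ∃ (n : ℕ) (a : Fin n → A) (b : Fin n → B), (∀ i, a i ∈ I) ∧ x = ∑ i, f (a i) * b i := by
  obtain ⟨t, ht, c, rfl⟩ := (Submodule.mem_span_image_iff_exists_fun B).1 hx
  let e := Fintype.equivFin t
  refine ⟨_, fun i => (e.symm i).1, fun i => c (e.symm i), fun i => ht (e.symm i).2, ?_⟩
  rw [e.symm.sum_comp fun i : t => f i.1 * c i]
  simp [mul_comm]

/-- Extension along a flat homomorphism commutes with the formation of `(J : x)`. -/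
theorem RingHom.Flat.exists_of_mul_mem_map (hf : f.Flat) {J : Ideal A} {x : A} {b : B}
    (h : f x * b ∈ J.map f) : b ∈ Ideal.map f (Submodule.comap (LinearMap.mulLeft A x) J) := by
  algebraize [f]
  obtain ⟨n, a, c, ha, hc⟩ := Ideal.exists_sum_of_mem_map h
  obtain ⟨m, d, y, hy, hd⟩ := Module.Flat.isTrivialRelation_of_sum_smul_eq_zero
    (R := A) (M := B) (ι := Option (Fin n)) (f := fun i => i.elim x fun i => - a i)
    (x := fun i => i.elim b c) (by
      simp [Fintype.sum_option, Algebra.smul_def, RingHom.algebraMap_toAlgebra, hc])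
  have hb : b = ∑ j, d none j • y j := hy none
  rw [hb]
  refine Ideal.sum_mem _ fun j _ => ?_
  rw [Algebra.smul_def]
  refine Ideal.mul_mem_right _ _ (Ideal.mem_map_of_mem _ ?_)
  have := hd j
  simp only [Fintype.sum_option, Option.elim_none, Option.elim_some, neg_mul,
    Finset.sum_neg_distrib, add_neg_eq_zero] at this
  change x * d none j ∈ J
  rw [this]
  exact Ideal.sum_mem _ fun i _ => Ideal.mul_mem_right _ _ (ha i)

/-- Extension along a flat homomorphism commutes with finite intersections, by the equational
criterion applied to an equality of two expressions. -/
theorem RingHom.Flat.map_inf (hf : f.Flat) (I J : Ideal A) :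
    (I ⊓ J).map f = I.map f ⊓ J.map f := by
  algebraize [f]
  refine le_antisymm (le_inf (Ideal.map_mono inf_le_left) (Ideal.map_mono inf_le_right)) ?_
  rintro x ⟨hI, hJ⟩
  obtain ⟨n, a, b, ha, rfl⟩ := Ideal.exists_sum_of_mem_map hI
  obtain ⟨n', a', b', ha', h⟩ := Ideal.exists_sum_of_mem_map hJ
  obtain ⟨m, d, y, hy, hd⟩ := Module.Flat.isTrivialRelation_of_sum_smul_eq_zero
    (R := A) (M := B) (ι := Fin n ⊕ Fin n') (f := Sum.elim a fun i => - a' i)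
    (x := Sum.elim b b') (by
      simp [Algebra.smul_def, RingHom.algebraMap_toAlgebra, h])
  have hb : ∀ i, b i = ∑ j, d (.inl i) j • y j := fun i => hy (.inl i)
  simp only [hb, Finset.mul_sum, Algebra.smul_def, RingHom.algebraMap_toAlgebra]
  rw [Finset.sum_comm]
  refine Ideal.sum_mem _ fun j _ => ?_
  simp only [← mul_assoc, ← map_mul, ← Finset.sum_mul, ← map_sum]
  refine Ideal.mul_mem_right _ _ (Ideal.mem_map_of_mem _ ⟨?_, ?_⟩)
  · exact Ideal.sum_mem _ fun i _ => Ideal.mul_mem_right _ _ (ha i)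
  · have := hd j
    simp only [Fintype.sum_sum_type, Sum.elim_inl, Sum.elim_inr, neg_mul,
      Finset.sum_neg_distrib, add_neg_eq_zero] at this
    rw [this]
    exact Ideal.sum_mem _ fun i _ => Ideal.mul_mem_right _ _ (ha' i)

end FlatRing

/-! ### Inverse images of ideal sheaves -/

section IdealSheaf

open Scheme

variable {X Y : Scheme.{u}}

theorem appLE_SpecMap_fromSpec {W : X.Opens} (hW : IsAffineOpen W) {R : CommRingCat.{u}}
    (φ : Γ(X, W) ⟶ R) (e : ⊤ ≤ (Spec.map φ ≫ hW.fromSpec) ⁻¹ᵁ W) :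
    (Spec.map φ ≫ hW.fromSpec).appLE W ⊤ e = φ ≫ (Scheme.ΓSpecIso R).inv := by
  have h1 : (Spec.map φ ≫ hW.fromSpec).appLE W ⊤ e =
      hW.fromSpec.app W ≫ (Spec.map φ).appLE (hW.fromSpec ⁻¹ᵁ W) ⊤ e :=
    Scheme.Hom.comp_appLE _ _ _ _ _
  have h2 : hW.fromSpec.app W = (Scheme.ΓSpecIso _).inv ≫
      (Spec Γ(X, W)).presheaf.map (eqToHom hW.fromSpec_preimage_self).op := hW.fromSpec_app_self
  have h3 : (Spec Γ(X, W)).presheaf.map (eqToHom hW.fromSpec_preimage_self).op ≫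
      (Spec.map φ).appLE (hW.fromSpec ⁻¹ᵁ W) ⊤ e = (Spec.map φ).appTop :=
    (Scheme.Hom.map_appLE _ _ _).trans (Scheme.Hom.appLE_eq_app _)
  rw [h1, h2, Scheme.ΓSpecIso_inv_naturality]
  exact (Category.assoc _ _ _).trans (congrArg ((Scheme.ΓSpecIso _).inv ≫ ·) h3)

theorem appLE_congr_hom {f g : X ⟶ Y} (h : f = g) {V : Y.Opens} {W : X.Opens} (e : W ≤ f ⁻¹ᵁ V)
    (e' : W ≤ g ⁻¹ᵁ V) : f.appLE V W e = g.appLE V W e' := by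
  subst h; rfl

/-- On affine opens, the inverse image of an ideal sheaf is the extension of ideals. -/
theorem ideal_comap (I : Y.IdealSheafData) (f : X ⟶ Y) {V : Y.Opens} (hV : IsAffineOpen V)
    {W : X.Opens} (hW : IsAffineOpen W) (e : W ≤ f ⁻¹ᵁ V) :
    (I.comap f).ideal ⟨W, hW⟩ = (I.ideal ⟨V, hV⟩).map (f.appLE V W e).hom := by
  refine le_antisymm ?_ ?_
  · let J₀ := (I.ideal ⟨V, hV⟩).map (f.appLE V W e).hom
    let j : Spec (.of (Γ(X, W) ⧸ J₀)) ⟶ X :=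
      Spec.map (CommRingCat.ofHom (Ideal.Quotient.mk J₀)) ≫ hW.fromSpec
    let r : CommRingCat.of (Γ(Y, V) ⧸ I.ideal ⟨V, hV⟩) ⟶ CommRingCat.of (Γ(X, W) ⧸ J₀) :=
      CommRingCat.ofHom (Ideal.quotientMap J₀ (f.appLE V W e).hom Ideal.le_comap_map)
    have hr : f.appLE V W e ≫ CommRingCat.ofHom (Ideal.Quotient.mk J₀) =
        CommRingCat.ofHom (Ideal.Quotient.mk (I.ideal ⟨V, hV⟩)) ≫ r := by
      ext x; rfl
    have hj : j ≫ f = (Spec.map r ≫ I.subschemeCover.f ⟨V, hV⟩) ≫ I.subschemeι := by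
      have h1 : (Spec.map r ≫ I.subschemeCover.f ⟨V, hV⟩) ≫ I.subschemeι =
          Spec.map r ≫ Spec.map (CommRingCat.ofHom (Ideal.Quotient.mk (I.ideal ⟨V, hV⟩))) ≫
            hV.fromSpec :=
        (Category.assoc _ _ _).trans (congrArg (Spec.map r ≫ ·)
          ((IdealSheafData.subschemeCover_map_subschemeι I ⟨V, hV⟩).trans
            (IdealSheafData.glueDataObjι_ι I ⟨V, hV⟩)))
      rw [h1]
      simp only [j, Category.assoc, ← IsAffineOpen.SpecMap_appLE_fromSpec f hV hW e]
      rw [← Spec.map_comp_assoc, hr, Spec.map_comp_assoc]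
    have h1 : I ≤ j.ker.map f := by
      rw [← Scheme.Hom.ker_comp, hj]
      exact I.ker_subschemeι.symm.le.trans (Scheme.Hom.le_ker_comp _ _)
    refine (IdealSheafData.le_map_iff_comap_le.1 h1 _).trans ((j.ideal_ker_le ⟨W, hW⟩).trans ?_)
    intro x hx
    rw [RingHom.mem_ker] at hx
    have e' : ⊤ ≤ j ⁻¹ᵁ W := fun y _ => by
      simp [j]
    have h2 : (j.appLE W ⊤ e').hom x = 0 := by
      have h3 : (j.app W).hom x = 0 := hx
      simp [Scheme.Hom.appLE, h3]
    rw [appLE_SpecMap_fromSpec] at h2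
    have h4 := (Scheme.ΓSpecIso (.of (Γ(X, W) ⧸ J₀))).symm.commRingCatIsoToRingEquiv.injective
      (h2.trans (map_zero _).symm)
    exact Ideal.Quotient.eq_zero_iff_mem.1 h4
  · rw [Ideal.map_le_iff_le_comap, ← (I.comap f).ker_subschemeι_app ⟨W, hW⟩, RingHom.comap_ker]
    intro x hx
    let m := IdealSheafData.subschemeMap (I.comap f) I f (I.le_map_comap f)
    have h : m ≫ I.subschemeι = (I.comap f).subschemeι ≫ f :=
      IdealSheafData.subschemeMap_subschemeι (I.comap f) I f (I.le_map_comap f)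
    have e1 : (I.comap f).subschemeι ⁻¹ᵁ W ≤ ((I.comap f).subschemeι ≫ f) ⁻¹ᵁ V :=
      fun y hy => e hy
    have h1 : f.appLE V W e ≫ (I.comap f).subschemeι.app W =
        ((I.comap f).subschemeι ≫ f).appLE V _ e1 := by
      rw [Scheme.Hom.app_eq_appLE, Scheme.Hom.appLE_comp_appLE]
    have e2 : (I.comap f).subschemeι ⁻¹ᵁ W ≤ (m ≫ I.subschemeι) ⁻¹ᵁ V := by rwa [h]
    have h2 : I.subschemeι.app V ≫ m.appLE _ _ e2 =
        ((I.comap f).subschemeι ≫ f).appLE V _ e1 :=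
      (Scheme.Hom.comp_appLE m I.subschemeι V _ e2).symm.trans (appLE_congr_hom h _ _)
    rw [← I.ker_subschemeι_app] at hx
    have hx' : (I.subschemeι.app V).hom x = 0 := hx
    have := congrArg (fun t => t.hom x) (h1.trans h2.symm)
    simp only [CommRingCat.hom_comp, RingHom.comp_apply] at this
    rw [hx', map_zero] at this
    exact this

theorem exists_affine_le_preimage (f : X ⟶ Y) (x : X) :
    ∃ (V : Y.Opens) (_ : IsAffineOpen V) (W : X.Opens) (_ : IsAffineOpen W),
      x ∈ W ∧ W ≤ f ⁻¹ᵁ V := by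
  obtain ⟨_, ⟨V, hV, rfl⟩, hxV, -⟩ :=
    Y.isBasis_affineOpens.exists_subset_of_mem_open (Set.mem_univ (f x)) isOpen_univ
  obtain ⟨_, ⟨W, hW, rfl⟩, hxW, hWV⟩ :=
    X.isBasis_affineOpens.exists_subset_of_mem_open (show x ∈ f ⁻¹ᵁ V from hxV)
      (f ⁻¹ᵁ V).isOpen
  exact ⟨V, hV, W, hW, hxW, hWV⟩

theorem ideal_le_of_forall_exists {I J : X.IdealSheafData}
    (h : ∀ x : X, ∃ W : X.affineOpens, x ∈ W.1 ∧ I.ideal W ≤ J.ideal W) : I ≤ J := by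
  choose W hW hI using h
  exact IdealSheafData.le_of_iSup_eq_top W
    (top_le_iff.1 fun x _ => Opens.mem_iSup.2 ⟨x, hW x⟩) hI

theorem comap_inf_of_flat (I J : Y.IdealSheafData) (f : X ⟶ Y) [AlgebraicGeometry.Flat f] :
    (I ⊓ J).comap f = I.comap f ⊓ J.comap f := by
  refine le_antisymm ((IdealSheafData.map_gc f).monotone_l.map_inf_le _ _)
    (ideal_le_of_forall_exists fun x => ?_)
  obtain ⟨V, hV, W, hW, hx, e⟩ := exists_affine_le_preimage f x
  refine ⟨⟨W, hW⟩, hx, ?_⟩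
  simp only [IdealSheafData.ideal_inf, Pi.inf_apply, ideal_comap _ f hV hW e]
  exact ((f.flat_appLE hV hW e).map_inf _ _).ge

end IdealSheaf

/-! ### Preserved closed subschemes -/

section Preserves

open scoped MonObj

variable {C : Type*} [Category C] [CartesianMonoidalCategory C]

theorem isPullback_whiskerLeft_snd (G : C) {X Y : C} (f : X ⟶ Y) :
    IsPullback (G ◁ f) (snd G X) (snd G Y) f :=
  ⟨⟨by simp⟩, ⟨Limits.PullbackCone.IsLimit.mk _ (fun s => lift (s.fst ≫ fst _ _) s.snd)
    (fun s => by
      refine CartesianMonoidalCategory.hom_ext _ _ (by simp) ?_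
      simp [s.condition])
    (fun s => by simp)
    (fun s m h1 h2 => by
      refine CartesianMonoidalCategory.hom_ext _ _ ?_ (by simpa using h2)
      simp [← h1])⟩⟩

theorem ker_of_isPullback {P X Y Z : Scheme.{u}} {g : P ⟶ X} {h : P ⟶ Z} {f : X ⟶ Y} {i : Z ⟶ Y}
    [IsClosedImmersion i] (sq : IsPullback g h f i) : g.ker = i.ker.comap f := by
  rw [← Scheme.IdealSheafData.ker_fst_of_isClosedImmersion, ← sq.isoPullback_hom_fst,
    Scheme.Hom.ker_comp_of_isIso]

variable {S : Scheme.{u}} (G : Over S) {X : Scheme.{u}} (s : X ⟶ S)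

/-- The closed subscheme `G ×_S Z` of `G ×_S X` has ideal `p⁻¹ I`. -/
theorem ker_whiskerLeft_subschemeι (I : X.IdealSheafData) :
    (G ◁ (Over.homMk I.subschemeι : Over.mk (I.subschemeι ≫ s) ⟶ Over.mk s)).left.ker =
      I.comap (projMap G s) := by
  have sq : IsPullback (G ◁ (Over.homMk I.subschemeι :
      Over.mk (I.subschemeι ≫ s) ⟶ Over.mk s)).left (snd G _).left (projMap G s) I.subschemeι :=
    (isPullback_whiskerLeft_snd G
      (Over.homMk I.subschemeι : Over.mk (I.subschemeι ≫ s) ⟶ Over.mk s)).map (Over.forget S)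
  rw [ker_of_isPullback sq, Scheme.IdealSheafData.ker_subschemeι]

variable [GrpObj G] [ModObj G (Over.mk s)]

/-- Preservation in terms of ideals: `G ×_S Z` maps into `Z` under the action. -/
theorem preserves_iff (I : X.IdealSheafData) :
    Preserves G s I ↔ I.comap (actMap G s) ≤ I.comap (projMap G s) := by
  rw [← Scheme.IdealSheafData.le_map_iff_comap_le, ← ker_whiskerLeft_subschemeι,
    ← Scheme.Hom.ker_comp]
  constructor
  · rintro ⟨b, hb⟩
    have := congrArg CommaMorphism.left hb
    have h : b.left ≫ I.subschemeι = (G ◁ (Over.homMk I.subschemeι :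
      Over.mk (I.subschemeι ≫ s) ⟶ Over.mk s)).left ≫ actMap G s := this
    rw [← h]
    exact I.ker_subschemeι.symm.le.trans (Scheme.Hom.le_ker_comp _ _)
  · intro h
    let b := IsClosedImmersion.lift I.subschemeι ((G ◁ (Over.homMk I.subschemeι :
      Over.mk (I.subschemeι ≫ s) ⟶ Over.mk s)).left ≫ actMap G s)
      (by rwa [Scheme.IdealSheafData.ker_subschemeι])
    have hb : b ≫ I.subschemeι = _ := IsClosedImmersion.lift_fac _ _ _
    refine ⟨Over.homMk b ?_, ?_⟩
    · have h1 : actMap G s ≫ s = (G ⊗ Over.mk s).hom := Over.w (overAct G s)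
      have h2 : b ≫ I.subschemeι ≫ s = _ :=
        (Category.assoc _ _ _).symm.trans (congrArg (· ≫ s) hb)
      refine h2.trans ((Category.assoc _ _ _).trans ?_)
      rw [h1]
      exact Over.w (G ◁ (Over.homMk I.subschemeι : Over.mk (I.subschemeι ≫ s) ⟶ Over.mk s))
    · ext1
      exact hb

/-- The involution `(g, x) ↦ (g⁻¹, g x)` of `G × X`. -/
def shear : G ⊗ Over.mk s ⟶ G ⊗ Over.mk s :=
  lift (fst _ _ ≫ GrpObj.inv) (overAct G s)

theorem shear_snd : (shear G s).left ≫ projMap G s = actMap G s :=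
  congrArg CommaMorphism.left (lift_snd _ _ : shear G s ≫ snd _ _ = _)

theorem shear_overAct : shear G s ≫ overAct G s = snd _ _ := by
  have h : shear G s = lift (fst G (Over.mk s))⁻¹ (fst G (Over.mk s) • snd G (Over.mk s)) := by
    simp [shear, Hom.inv_def, Hom.smul_def]
  rw [h]
  exact inv_smul_smul (fst G (Over.mk s)) (snd G (Over.mk s))

theorem shear_act : (shear G s).left ≫ actMap G s = projMap G s :=
  congrArg CommaMorphism.left (shear_overAct G s)

instance : IsIso (shear G s) := by
  have h : shear G s ≫ shear G s = 𝟙 _ := by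
    refine CartesianMonoidalCategory.hom_ext _ _ ?_ ?_
    · rw [Category.assoc, shear, lift_fst, lift_fst_assoc, Category.assoc]
      simp
    · rw [Category.assoc]
      nth_rw 2 [shear]
      rw [lift_snd, shear_overAct, Category.id_comp]
  exact ⟨shear G s, h, h⟩

instance : IsIso (shear G s).left :=
  inferInstanceAs (IsIso ((Over.forget S).map (shear G s)))

/-- The inclusion of `a⁻¹ I` in `p⁻¹ I` is an equality, since the shear involution exchanges `a`
and `p`. -/
theorem comap_actMap_eq_of_preserves {I : X.IdealSheafData} (h : Preserves G s I) :
    I.comap (actMap G s) = I.comap (projMap G s) := by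
  rw [preserves_iff] at h
  refine le_antisymm h ?_
  have := Scheme.IdealSheafData.comap_mono (f := (shear G s).left) h
  simpa only [← Scheme.IdealSheafData.comap_comp, shear_snd, shear_act] using this

instance [AlgebraicGeometry.Flat G.hom] : AlgebraicGeometry.Flat (projMap G s) :=
  inferInstanceAs (AlgebraicGeometry.Flat (Limits.pullback.snd G.hom s))

instance [AlgebraicGeometry.Flat G.hom] : AlgebraicGeometry.Flat (actMap G s) := by
  rw [← shear_snd]
  exact inferInstanceAs (AlgebraicGeometry.Flat ((shear G s).left ≫ projMap G s))

end Preserves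

end

noncomputable section

/-! ### Reduced intersections -/

section Reduced

open Scheme

variable {X : Scheme.{u}}

theorem radical_eq_of_isReduced_subscheme (I : X.IdealSheafData)
    [AlgebraicGeometry.IsReduced I.subscheme] : I.radical = I := by
  ext U : 2
  have : (I.ideal U).IsRadical := by
    rw [← I.ker_subschemeι_app U]
    exact (RingHom.ker_isRadical_iff_reduced_of_surjective
      (I.subschemeι_app_surjective U)).2 inferInstance
  exact this.radical

/-- The intersection of the ideals of the members of `T` is the ideal of their union, if that is
closed. -/
theorem biInf_varietyIdeal {T : Set (IrreducibleCloseds X)}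
    (Z : Closeds X) (hZ : (Z : Set X) = ⋃ B ∈ T, (B : Set X)) :
    ⨅ B ∈ T, varietyIdeal B = IdealSheafData.vanishingIdeal Z := by
  have : Z = ⨆ B ∈ T, (⟨B, B.isClosed⟩ : Closeds X) := by
    refine le_antisymm ?_ (iSup₂_le fun B hB x hx => hZ.ge (Set.mem_biUnion hB hx))
    intro x hx
    obtain ⟨B, hB, hxB⟩ := Set.mem_iUnion₂.1 (hZ.le hx)
    exact (le_iSup₂ (f := fun (B : IrreducibleCloseds X) (_ : B ∈ T) =>
      (⟨B, B.isClosed⟩ : Closeds X)) B hB) hxB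
  simp only [this, IdealSheafData.vanishingIdeal_iSup, varietyIdeal]

theorem support_varietyIdeal (A : IrreducibleCloseds X) :
    (varietyIdeal A).support = ⟨A, A.isClosed⟩ :=
  Closeds.ext (IdealSheafData.coe_support_vanishingIdeal _)

/-- The scheme-theoretic intersection of `A` with a union `Z` is the reduced one. -/
theorem HasReducedIntersections.sup_vanishingIdeal (hX : HasReducedIntersections X)
    {A : IrreducibleCloseds X} (hA : A ∈ minimalFamily X) {T : Set (IrreducibleCloseds X)}
    (hT : T ⊆ minimalFamily X) (Z : Closeds X) (hZ : (Z : Set X) = ⋃ B ∈ T, (B : Set X)) :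
    varietyIdeal A ⊔ IdealSheafData.vanishingIdeal Z =
      IdealSheafData.vanishingIdeal (⟨A, A.isClosed⟩ ⊓ Z) := by
  have := hX A hA T hT
  rw [biInf_varietyIdeal Z hZ] at this
  rw [← radical_eq_of_isReduced_subscheme (varietyIdeal A ⊔ _),
    ← IdealSheafData.vanishingIdeal_support, IdealSheafData.support_sup, support_varietyIdeal]
  congr 2

/-- The scheme-theoretic intersection of any members of the minimal family is reduced: one
intersects with one member at a time, the previous intersection being the union of its components. -/
theorem HasReducedIntersections.biSup_varietyIdeal [AlgebraicGeometry.IsReduced X]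
    [NoetherianSpace X] (hX : HasReducedIntersections X)
    {S : Set (IrreducibleCloseds X)} (hS : S ⊆ minimalFamily X) (Z : Closeds X)
    (hZ : (Z : Set X) = ⋂ A ∈ S, (A : Set X)) :
    ⨆ A ∈ S, varietyIdeal A = IdealSheafData.vanishingIdeal Z := by
  have hfin : S.Finite := finite_minimalFamily.subset hS
  induction S, hfin using Set.Finite.induction_on generalizing Z with
  | empty =>
    have : Z = ⊤ := Closeds.ext (by simpa using hZ)
    simp [this, nilradical_eq_bot]
  | @insert A S hA _ ih =>
    let Z' : Closeds X := ⟨⋂ A ∈ S, (A : Set X), isClosed_biInter fun B _ => B.isClosed⟩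
    rw [iSup_insert, ih ((Set.subset_insert _ _).trans hS) Z' rfl]
    have hT : {C : IrreducibleCloseds X | IsComponentOf C Z'} ⊆ minimalFamily X := fun C hC =>
      intersectDecompose_minimalFamily S ((Set.subset_insert _ _).trans hS) C hC
    rw [hX.sup_vanishingIdeal (hS (Set.mem_insert _ _)) hT Z' (coe_eq_biUnion_isComponentOf Z')]
    congr 1
    refine Closeds.ext ?_
    rw [hZ, Set.biInter_insert]
    rfl

end Reduced

/-! ### Connected groups preserve components -/

section Components

open Scheme

/-- For a radical ideal, `(J : x ^ n) = (J : x)`, and flat extension preserves this although it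
need not preserve radical ideals. -/
theorem Ideal.IsRadical.mem_map_of_pow_mul_mem {A B : Type*} [CommRing A] [CommRing B]
    {f : A →+* B} (hf : f.Flat) {J : Ideal A} (hJ : J.IsRadical) {x : A} {b : B} {n : ℕ}
    (h : f x ^ n * b ∈ J.map f) : f x * b ∈ J.map f := by
  rw [← map_pow] at h
  have hle : Ideal.map f (Submodule.comap (LinearMap.mulLeft A (x ^ n)) J) ≤
      Submodule.comap (LinearMap.mulLeft B (f x)) (J.map f) := ?_
  · exact hle (hf.exists_of_mul_mem_map h)
  refine Ideal.map_le_iff_le_comap.2 fun y hy => ?_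
  have hy' : x ^ n * y ∈ J := hy
  change f x * f y ∈ J.map f
  rw [← map_mul]
  refine Ideal.mem_map_of_mem _ (hJ ⟨n + 1, ?_⟩)
  rw [mul_pow, pow_succ, pow_succ]
  have : x ^ n * x * (y ^ n * y) = (x ^ n * y) * (x * y ^ n) := by ring
  rw [this]
  exact Ideal.mul_mem_right _ _ hy'

variable {X Y : Scheme.{u}}

/-- The hypothesis excludes the affine opens that miss `C`, where the ideal is the whole ring. -/
theorem isPrime_varietyIdeal (C : IrreducibleCloseds X) (V : X.affineOpens)
    (h : ((C : Set X) ∩ V.1).Nonempty) : ((varietyIdeal C).ideal V).IsPrime := by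
  have e : (varietyIdeal C).ideal V =
      PrimeSpectrum.vanishingIdeal (V.2.fromSpec ⁻¹' (C : Set X)) := rfl
  rw [e, ← PrimeSpectrum.isIrreducible_iff_vanishingIdeal_isPrime]
  have hV : IsAffineOpen V.1 := V.2
  refine ⟨?_, C.isIrreducible.isPreirreducible.preimage hV.fromSpec.isOpenEmbedding⟩
  obtain ⟨x, hxC, hxV⟩ := h
  obtain ⟨y, rfl⟩ : x ∈ Set.range V.2.fromSpec := V.2.range_fromSpec.ge hxV
  exact ⟨y, hxC⟩

theorem not_vanishingIdeal_le (C : IrreducibleCloseds X) (Z : Closeds X)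
    (hCZ : ¬ (C : Set X) ⊆ Z) (V : X.affineOpens) (h : ((C : Set X) ∩ V.1).Nonempty) :
    ¬ (IdealSheafData.vanishingIdeal Z).ideal V ≤ (varietyIdeal C).ideal V := by
  intro hle
  have h1 : V.2.fromSpec ⁻¹' (C : Set X) ⊆ V.2.fromSpec ⁻¹' (Z : Set X) :=
    (PrimeSpectrum.vanishingIdeal_anti_mono_iff
      (Z.isClosed.preimage V.2.fromSpec.continuous)).2 hle
  have h2 : (C : Set X) ⊆ (V.1 : Set X)ᶜ ∪ Z := by
    intro x hx
    by_cases hxV : x ∈ V.1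
    · obtain ⟨y, rfl⟩ : x ∈ Set.range V.2.fromSpec := V.2.range_fromSpec.ge hxV
      exact Or.inr (h1 hx)
    · exact Or.inl hxV
  rcases isPreirreducible_iff_isClosed_union_isClosed.1 C.isIrreducible.isPreirreducible _ _
    V.1.isOpen.isClosed_compl Z.isClosed h2 with h3 | h3
  · obtain ⟨x, hxC, hxV⟩ := h
    exact h3 hxC hxV
  · exact hCZ h3

/-- Let `p` and `a` be flat morphisms, `Z` a closed subset whose ideal has the same inverse image
under both, and `C` a component of `Z` with `p⁻¹ C ⊆ a⁻¹ C`. Then the same inclusion holds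
scheme-theoretically. -/
theorem comap_varietyIdeal_le [NoetherianSpace X] (p a : Y ⟶ X) [AlgebraicGeometry.Flat p]
    [AlgebraicGeometry.Flat a] (Z : Closeds X)
    (hZ : (IdealSheafData.vanishingIdeal Z).comap a = (IdealSheafData.vanishingIdeal Z).comap p)
    (C : IrreducibleCloseds X) (hC : IsComponentOf C Z)
    (hpa : p ⁻¹' (C : Set X) ⊆ a ⁻¹' (C : Set X)) :
    (varietyIdeal C).comap a ≤ (varietyIdeal C).comap p := by
  -- the union `Z'` of the other components
  let T : Set (IrreducibleCloseds X) := {D | IsComponentOf D Z} \ {C}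
  have hT : T.Finite := (finite_isComponentOf Z.isClosed).sdiff
  let Z' : Closeds X := ⟨⋃ D ∈ T, (D : Set X), hT.isClosed_biUnion fun D _ => D.isClosed⟩
  have hCZ' : ¬ (C : Set X) ⊆ Z' := by
    intro h
    have hfin : ((fun D : IrreducibleCloseds X => (D : Set X)) '' T).Finite := hT.image _
    obtain ⟨t, ht, hCt⟩ := isIrreducible_iff_sUnion_isClosed.1 C.isIrreducible hfin.toFinset
      (by simp only [Set.Finite.mem_toFinset]; rintro _ ⟨D, -, rfl⟩; exact D.isClosed)
      (by simpa [Set.sUnion_image, Z'] using h)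
    obtain ⟨D, hD, rfl⟩ := hfin.mem_toFinset.1 ht
    exact hD.2 (le_antisymm (hC.2 hD.1.1 hCt) hCt)
  have hZC : (Z : Set X) ⊆ C ∪ Z' := by
    intro x hx
    obtain ⟨D, hD, hx'⟩ := Set.mem_iUnion₂.1 ((coe_eq_biUnion_isComponentOf Z).le hx)
    by_cases h : D = C
    · exact Or.inl (h ▸ hx')
    · exact Or.inr (Set.mem_biUnion (⟨hD, h⟩ : D ∈ T) hx')
  -- functions on `a⁻¹ C` times functions on `p⁻¹ Z'` vanish on `p⁻¹ Z`
  have hprod : (varietyIdeal C).comap a * (IdealSheafData.vanishingIdeal Z').comap p ≤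
      ((IdealSheafData.vanishingIdeal Z).comap p).radical := by
    rw [← IdealSheafData.vanishingIdeal_support, ← IdealSheafData.le_support_iff_le_vanishingIdeal,
      IdealSheafData.support_mul, IdealSheafData.support_comap, IdealSheafData.support_comap,
      IdealSheafData.support_comap, support_varietyIdeal]
    intro y hy
    have hy' : p y ∈ (Z : Set X) := by
      simpa only [IdealSheafData.coe_support_vanishingIdeal] using
        (show p y ∈ ((IdealSheafData.vanishingIdeal Z).support : Set X) from hy)
    rcases hZC hy' with h | h
    · exact Or.inl (hpa h)
    · refine Or.inr (show p y ∈ ((IdealSheafData.vanishingIdeal Z').support : Set X) from ?_)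
      simpa only [IdealSheafData.coe_support_vanishingIdeal] using h
  refine ideal_le_of_forall_exists fun y => ?_
  obtain ⟨_, ⟨U, hU, rfl⟩, hyU, -⟩ :=
    X.isBasis_affineOpens.exists_subset_of_mem_open (Set.mem_univ (a y)) isOpen_univ
  obtain ⟨_, ⟨V, hV, rfl⟩, hyV, -⟩ :=
    X.isBasis_affineOpens.exists_subset_of_mem_open (Set.mem_univ (p y)) isOpen_univ
  obtain ⟨_, ⟨W, hW, rfl⟩, hyW, hWUV⟩ :=
    Y.isBasis_affineOpens.exists_subset_of_mem_open
      (show y ∈ ((a ⁻¹ᵁ U ⊓ p ⁻¹ᵁ V : Y.Opens) : Set Y) from ⟨hyU, hyV⟩)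
      (a ⁻¹ᵁ U ⊓ p ⁻¹ᵁ V).isOpen
  have eU : W ≤ a ⁻¹ᵁ U := fun w hw => (hWUV hw).1
  have eV : W ≤ p ⁻¹ᵁ V := fun w hw => (hWUV hw).2
  refine ⟨⟨W, hW⟩, hyW, ?_⟩
  by_cases hCV : ((C : Set X) ∩ V).Nonempty
  swap
  · have : (varietyIdeal C).ideal ⟨V, hV⟩ = ⊤ := by
      have e : (varietyIdeal C).ideal ⟨V, hV⟩ =
        PrimeSpectrum.vanishingIdeal (hV.fromSpec ⁻¹' (C : Set X)) := rfl
      have e' : hV.fromSpec ⁻¹' (C : Set X) = ∅ := by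
        refine Set.eq_empty_of_forall_notMem fun z hz => hCV ⟨_, hz, ?_⟩
        exact hV.range_fromSpec.le ⟨z, rfl⟩
      exact e.trans ((congrArg _ e').trans PrimeSpectrum.vanishingIdeal_empty)
    rw [ideal_comap (varietyIdeal C) p hV hW eV, this, Ideal.map_top]
    exact le_top
  have hprime : ((varietyIdeal C).ideal ⟨V, hV⟩).IsPrime := isPrime_varietyIdeal C ⟨V, hV⟩ hCV
  obtain ⟨g, hg, hgC⟩ := SetLike.not_le_iff_exists.1 (not_vanishingIdeal_le C Z' hCZ' ⟨V, hV⟩ hCV)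
  rw [ideal_comap (varietyIdeal C) a hU hW eU, Ideal.map_le_iff_le_comap]
  intro f hf
  rw [Ideal.mem_comap]
  have hfa := a.flat_appLE hU hW eU
  have hfp := p.flat_appLE hV hW eV
  have hJa := ideal_comap (IdealSheafData.vanishingIdeal Z) a hU hW eU
  have hJp := ideal_comap (IdealSheafData.vanishingIdeal Z) p hV hW eV
  rw [hZ] at hJa
  set F := (a.appLE U W eU).hom f
  set H := (p.appLE V W eV).hom g
  have h1 : F * H ∈ (((IdealSheafData.vanishingIdeal Z).comap p).ideal ⟨W, hW⟩).radical := by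
    refine hprod ⟨W, hW⟩ (Ideal.mul_mem_mul ?_ ?_)
    · rw [ideal_comap (varietyIdeal C) a hU hW eU]
      exact Ideal.mem_map_of_mem _ hf
    · rw [ideal_comap _ p hV hW eV]
      exact Ideal.mem_map_of_mem _ hg
  obtain ⟨n, hn⟩ := h1
  -- By flatness of `a` the exponent of `F` can be lowered to `1`, and by flatness of `p` the factor
  -- `H ^ n` can be cancelled: `g` is not in the prime ideal of `C`.
  rw [mul_pow, hJa] at hn
  have hrad : ((IdealSheafData.vanishingIdeal Z).ideal ⟨U, hU⟩).IsRadical :=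
    PrimeSpectrum.isRadical_vanishingIdeal _
  have h2 := hrad.mem_map_of_pow_mul_mem hfa hn
  rw [← hJa, hJp] at h2
  have h3 : (IdealSheafData.vanishingIdeal Z).ideal ⟨V, hV⟩ ≤ (varietyIdeal C).ideal ⟨V, hV⟩ :=
    IdealSheafData.vanishingIdeal_antimono (show (⟨C, C.isClosed⟩ : Closeds X) ≤ Z from hC.1)
      ⟨V, hV⟩
  have h4 := Ideal.map_mono h3 h2
  rw [mul_comm, ← map_pow] at h4
  rw [ideal_comap (varietyIdeal C) p hV hW eV]
  refine Ideal.map_mono (fun y hy => ?_) (hfp.exists_of_mul_mem_map h4)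
  exact (hprime.mem_or_mem (show g ^ n * y ∈ _ from hy)).resolve_left
    fun h => hgC (hprime.mem_of_pow_mem _ h)

variable {k : Type u} [Field k] (G : Over (Spec (.of k))) [GrpObj G] (s : X ⟶ Spec (.of k))
  [ModObj G (Over.mk s)]

/-- The unit of `G` gives a point of `G × X` over `x` that acts trivially. -/
theorem exists_projMap_actMap_eq (x : X) : ∃ y, projMap G s y = x ∧ actMap G s y = x := by
  let e : Over.mk s ⟶ G ⊗ Over.mk s := lift (toUnit _ ≫ MonObj.one) (𝟙 _)
  have h1 : e ≫ snd _ _ = 𝟙 _ := lift_snd _ _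
  have h2 : e ≫ overAct G s = 𝟙 _ := by
    have : e = (λ_ _).inv ≫ MonObj.one ▷ Over.mk s := by
      refine CartesianMonoidalCategory.hom_ext _ _ ?_ ?_ <;> simp [e]
    rw [this, Category.assoc]
    have := ModObj.one_smul_self (M := G) (Over.mk s)
    simp
  refine ⟨e.left x, ?_, ?_⟩
  · exact congrArg (fun f : Over.mk s ⟶ Over.mk s => f.left x) h1
  · exact congrArg (fun f : Over.mk s ⟶ Over.mk s => f.left x) h2

/-- If `Z` is stable under a connected group then so is each component `C`: the closure of `G · C`
is an irreducible subset of `Z` that contains `C`. -/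
theorem preimage_projMap_subset [AlgebraicGeometry.LocallyOfFiniteType G.hom]
    [ConnectedSpace G.left] (Z : Set X) (hZ : IsClosed Z)
    (hpa : projMap G s ⁻¹' Z ⊆ actMap G s ⁻¹' Z) (C : IrreducibleCloseds X)
    (hC : IsComponentOf C Z) :
    projMap G s ⁻¹' (C : Set X) ⊆ actMap G s ⁻¹' (C : Set X) := by
  have : GrpObj (Over.mk G.hom) := inferInstanceAs (GrpObj G)
  have : GeometricallyIrreducible G.hom := geometricallyIrreducible_of_grpObj G.hom
  have : GeometricallyIrreducible (projMap G s) :=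
    inferInstanceAs (GeometricallyIrreducible (Limits.pullback.snd G.hom s))
  have : UniversallyOpen (projMap G s) :=
    inferInstanceAs (UniversallyOpen (Limits.pullback.snd G.hom s))
  have hirr : IsIrreducible (projMap G s ⁻¹' (C : Set X)) :=
    (projMap G s).isIrreducible_preimage (projMap G s).isOpenMap C.isIrreducible
  let D : IrreducibleCloseds X := ⟨closure (actMap G s '' (projMap G s ⁻¹' (C : Set X))),
    (hirr.image _ (actMap G s).continuous.continuousOn).closure, isClosed_closure⟩
  have hD : (D : Set X) ⊆ Z := closure_minimal (Set.image_subset_iff.2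
    ((Set.preimage_mono hC.1).trans hpa)) hZ
  have hCD : C ≤ D := fun x hx => by
    obtain ⟨y, h1, h2⟩ := exists_projMap_actMap_eq G s x
    exact subset_closure ⟨y, by rwa [Set.mem_preimage, h1], h2⟩
  exact Set.image_subset_iff.1 (subset_closure.trans (hC.2 hD hCD))

/-- The preserved members of the minimal family have the intersect-decompose property, so they are
all of it. -/
theorem preserves_of_mem_minimalFamily [AlgebraicGeometry.IsReduced X] [NoetherianSpace X]
    (hX : HasReducedIntersections X) [AlgebraicGeometry.LocallyOfFiniteType G.hom]
    [ConnectedSpace G.left] (A : IrreducibleCloseds X) (hA : A ∈ minimalFamily X) :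
    Preserves G s (varietyIdeal A) := by
  suffices h : IntersectDecompose {A | A ∈ minimalFamily X ∧ Preserves G s (varietyIdeal A)} from
    (hA _ h).2
  intro S hS C hC
  have hSm : S ⊆ minimalFamily X := fun A hA => (hS hA).1
  refine ⟨intersectDecompose_minimalFamily S hSm C hC, ?_⟩
  let Z : Closeds X := ⟨⋂ A ∈ S, (A : Set X), isClosed_biInter fun B _ => B.isClosed⟩
  have hJ := hX.biSup_varietyIdeal hSm Z rfl
  have hZ : (IdealSheafData.vanishingIdeal Z).comap (actMap G s) =
      (IdealSheafData.vanishingIdeal Z).comap (projMap G s) := by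
    rw [← hJ, (IdealSheafData.map_gc (actMap G s)).l_iSup₂,
      (IdealSheafData.map_gc (projMap G s)).l_iSup₂]
    exact iSup_congr fun A => iSup_congr fun hA => comap_actMap_eq_of_preserves G s (hS hA).2
  have : AlgebraicGeometry.Flat G.hom := inferInstance
  have hpa : projMap G s ⁻¹' (Z : Set X) ⊆ actMap G s ⁻¹' (Z : Set X) := by
    have h := congrArg (fun I => (I.support : Set (actSource G s))) hZ
    simp only [IdealSheafData.support_comap, Closeds.coe_preimage,
      IdealSheafData.coe_support_vanishingIdeal] at h
    exact h.ge
  rw [preserves_iff]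
  exact comap_varietyIdeal_le _ _ Z hZ C hC
    (preimage_projMap_subset G s Z Z.isClosed hpa C hC)

end Components

end

noncomputable section

/-! ### Sheaves of modules and their sections over affine opens -/

section Sections

open Scheme

variable {X Y : Scheme.{u}} {M N : X.Modules}

/-- Sections that agree locally are equal. -/
theorem Scheme.Modules.section_ext_of_local {U : X.Opens} {s t : Γ(M, U)}
    (h : ∀ x ∈ U, ∃ (V : X.Opens) (i : V ≤ U), x ∈ V ∧
      M.presheaf.map (homOfLE i).op s = M.presheaf.map (homOfLE i).op t) : s = t := by
  choose! V i hV hst using h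
  refine TopCat.Sheaf.eq_of_locally_eq' ⟨_, M.isSheaf⟩ (fun x : U => V x.1) U
    (fun x => homOfLE (i x.1 x.2)) (fun x hx => ?_) _ _ fun x => hst x.1 x.2
  exact Opens.mem_iSup.2 ⟨⟨x, hx⟩, hV x hx⟩

theorem exists_affine_mem_le {U : X.Opens} {x : X} (hx : x ∈ U) :
    ∃ V : X.Opens, IsAffineOpen V ∧ V ≤ U ∧ x ∈ V := by
  obtain ⟨_, ⟨V, hV, rfl⟩, hxV, hVU⟩ :=
    X.isBasis_affineOpens.exists_subset_of_mem_open (show x ∈ (U : Set X) from hx) U.isOpen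
  exact ⟨V, hV, hVU, hxV⟩

theorem Scheme.Modules.app_map (φ : M ⟶ N) {U V : X.Opens} (i : V ≤ U) (s : Γ(M, U)) :
    φ.app V (M.presheaf.map (homOfLE i).op s) = N.presheaf.map (homOfLE i).op (φ.app U s) :=
  congr($(φ.mapPresheaf.naturality (homOfLE i).op) s)

theorem Scheme.Modules.hom_ext_of_affine {φ ψ : M ⟶ N}
    (h : ∀ V, IsAffineOpen V → ∀ s, φ.app V s = ψ.app V s) : φ = ψ := by
  refine Scheme.Modules.hom_ext _ _ fun U => ?_
  ext s
  refine Scheme.Modules.section_ext_of_local fun x hx => ?_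
  obtain ⟨V, hV, hVU, hxV⟩ := exists_affine_mem_le hx
  refine ⟨V, hVU, hxV, ?_⟩
  rw [← Scheme.Modules.app_map, ← Scheme.Modules.app_map, h V hV]

theorem Scheme.Modules.epi_of_affine {φ : M ⟶ N}
    (h : ∀ V, IsAffineOpen V → Function.Surjective (φ.app V)) : Epi φ := by
  refine ⟨fun f g hfg => Scheme.Modules.hom_ext_of_affine fun V hV s => ?_⟩
  obtain ⟨t, rfl⟩ := h V hV s
  have := congrArg (fun f => Scheme.Modules.Hom.app f V t) hfg
  simpa using this

theorem Scheme.Modules.mono_of_affine {φ : M ⟶ N}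
    (h : ∀ V, IsAffineOpen V → ∀ s, φ.app V s = 0 → s = 0) : Mono φ := by
  refine Preadditive.mono_of_cancel_zero _ fun f hf =>
    Scheme.Modules.hom_ext_of_affine fun V hV s => h V hV _ ?_
  have := congrArg (fun f => Scheme.Modules.Hom.app f V s) hf
  simpa using this

theorem Scheme.Modules.app_injective (φ : M ⟶ N) [Mono φ] (U : X.Opens) :
    Function.Injective (φ.app U) := by
  have h1 : Mono ((Modules.toPresheaf X).map φ) := inferInstance
  have h2 : Mono (φ.app U) := (NatTrans.mono_iff_mono_app _).1 h1 (.op U)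
  exact (AddCommGrpCat.mono_iff_injective _).1 h2

end Sections

/-! ### Quotients of the structure sheaf -/

section Quotient

open Scheme Limits

variable {X : Scheme.{u}}

/-- `q` exhibits `F` as the quotient of the structure sheaf by the ideal sheaf `I`, on sections
over affine opens. -/
structure IsQuotientBy {F : X.Modules} (q : structureModule X ⟶ F) (I : X.IdealSheafData) :
    Prop where
  surjective : ∀ V : X.affineOpens, Function.Surjective (q.app V)
  app_eq_zero_iff : ∀ (V : X.affineOpens) (a : Γ(X, V)), q.app V a = 0 ↔ a ∈ I.ideal V

theorem isQuotientBy_comorphism (I : X.IdealSheafData) :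
    IsQuotientBy (F := closedStructureModule I) (comorphism I.subschemeι) I where
  surjective V := I.subschemeι_app_surjective V
  app_eq_zero_iff V a := by
    rw [← I.ker_subschemeι_app V]
    exact Iff.rfl

variable {F F' : X.Modules} {q : structureModule X ⟶ F} {q' : structureModule X ⟶ F'}
  {I I' : X.IdealSheafData}

theorem IsQuotientBy.epi (h : IsQuotientBy q I) : Epi q :=
  Modules.epi_of_affine fun V hV => h.surjective ⟨V, hV⟩

/-- `𝒪/I` maps to `𝒪/I'` when `I ≤ I'`. -/
theorem IsQuotientBy.exists_factor (h : IsQuotientBy q I) (h' : IsQuotientBy q' I')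
    (hI : I ≤ I') : ∃ r : F ⟶ F', q ≫ r = q' := by
  have := h.epi
  refine ⟨Abelian.epiDesc q q' (Modules.hom_ext_of_affine fun V hV s => ?_),
    Abelian.comp_epiDesc _ _ _⟩
  refine (h'.app_eq_zero_iff ⟨V, hV⟩ _).2 (hI ⟨V, hV⟩ ((h.app_eq_zero_iff ⟨V, hV⟩ _).1 ?_))
  exact congrArg (fun f => Modules.Hom.app f V s) (kernel.condition q)

/-- Exactness on sections over affine opens implies exactness. -/
theorem exact_of_affine {A B C : X.Modules} {f : A ⟶ B} {g : B ⟶ C} (w : f ≫ g = 0)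
    (h : ∀ V, IsAffineOpen V → ∀ t, g.app V t = 0 → ∃ s, f.app V s = t) :
    (ShortComplex.mk f g w).Exact := by
  rw [ShortComplex.exact_iff_epi_kernel_lift]
  refine Modules.epi_of_affine fun V hV s => ?_
  have hs : g.app V ((kernel.ι g).app V s) = 0 :=
    congrArg (fun f => Modules.Hom.app f V s) (kernel.condition g)
  obtain ⟨t, ht⟩ := h V hV _ hs
  refine ⟨t, Modules.app_injective (kernel.ι g) V ?_⟩
  rw [← ht]
  exact congrArg (fun f => Modules.Hom.app f V t) (kernel.lift_ι g f w)

theorem biprod_app_ext {A B : X.Modules} {U : X.Opens} {s t : Γ(A ⊞ B, U)}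
    (h₁ : (biprod.fst : A ⊞ B ⟶ A).app U s = (biprod.fst : A ⊞ B ⟶ A).app U t)
    (h₂ : (biprod.snd : A ⊞ B ⟶ B).app U s = (biprod.snd : A ⊞ B ⟶ B).app U t) : s = t := by
  have key : ∀ s : Γ(A ⊞ B, U), s =
      (biprod.inl : A ⟶ A ⊞ B).app U ((biprod.fst : A ⊞ B ⟶ A).app U s) +
        (biprod.inr : B ⟶ A ⊞ B).app U ((biprod.snd : A ⊞ B ⟶ B).app U s) := fun s =>
    congrArg (fun f : A ⊞ B ⟶ A ⊞ B => f.app U s) biprod.total.symm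
  rw [key s, key t, h₁, h₂]

variable {K L : X.Modules} {k : structureModule X ⟶ K} {l : structureModule X ⟶ L}

theorem IsQuotientBy.comp_sub_eq_zero (hk : IsQuotientBy k (I ⊓ I'))
    {rI : K ⟶ F} {rI' : K ⟶ F'} {rL : F ⟶ L} {rL' : F' ⟶ L}
    (hrI : k ≫ rI = q) (hrI' : k ≫ rI' = q') (hrL : q ≫ rL = l) (hrL' : q' ≫ rL' = l) :
    (rI ≫ biprod.inl + rI' ≫ biprod.inr) ≫ (biprod.fst ≫ rL - biprod.snd ≫ rL') = 0 := by
  have := hk.epi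
  rw [← cancel_epi k]
  simp [reassoc_of% hrI, reassoc_of% hrI', hrL, hrL']

/-- The Mayer–Vietoris sequence `0 → 𝒪/(I ∩ I') → 𝒪/I ⊕ 𝒪/I' → 𝒪/(I + I') → 0`. -/
theorem IsQuotientBy.shortExact (h : IsQuotientBy q I) (h' : IsQuotientBy q' I')
    (hk : IsQuotientBy k (I ⊓ I')) (hl : IsQuotientBy l (I ⊔ I'))
    {rI : K ⟶ F} {rI' : K ⟶ F'} {rL : F ⟶ L} {rL' : F' ⟶ L}
    (hrI : k ≫ rI = q) (hrI' : k ≫ rI' = q') (hrL : q ≫ rL = l) (hrL' : q' ≫ rL' = l)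
    (w : (rI ≫ biprod.inl + rI' ≫ biprod.inr) ≫ (biprod.fst ≫ rL - biprod.snd ≫ rL') = 0) :
    (ShortComplex.mk _ _ w).ShortExact where
  exact := exact_of_affine w fun V hV t ht => by
    obtain ⟨a, ha⟩ := h.surjective ⟨V, hV⟩ ((biprod.fst : F ⊞ F' ⟶ F).app V t)
    obtain ⟨b, hb⟩ := h'.surjective ⟨V, hV⟩ ((biprod.snd : F ⊞ F' ⟶ F').app V t)
    have h1 : l.app V (a - b) = 0 := by
      have e1 : rL.app V ((biprod.fst : F ⊞ F' ⟶ F).app V t) = l.app V a := by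
        rw [← ha, ← hrL]; rfl
      have e2 : rL'.app V ((biprod.snd : F ⊞ F' ⟶ F').app V t) = l.app V b := by
        rw [← hb, ← hrL']; rfl
      rw [map_sub, ← e1, ← e2]
      exact ht
    obtain ⟨x, y, hx, hy, hxy⟩ : ∃ x y : Γ(structureModule X, V),
        q.app V x = 0 ∧ q'.app V y = 0 ∧ x + y = a - b := by
      obtain ⟨x, hx, y, hy, hxy⟩ := Submodule.mem_sup.1
        ((hl.app_eq_zero_iff ⟨V, hV⟩ (a - b)).1 h1)
      exact ⟨x, y, (h.app_eq_zero_iff ⟨V, hV⟩ x).2 hx, (h'.app_eq_zero_iff ⟨V, hV⟩ y).2 hy, hxy⟩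
    refine ⟨k.app V (a - x), biprod_app_ext ?_ ?_⟩
    · have e : (rI ≫ biprod.inl + rI' ≫ biprod.inr) ≫ (biprod.fst : F ⊞ F' ⟶ F) = rI := by simp
      refine (congrArg (fun f : K ⟶ F => f.app V (k.app V (a - x))) e).trans ?_
      refine (congrArg (fun f : structureModule X ⟶ F => f.app V (a - x)) hrI).trans ?_
      rw [map_sub, ha, hx, sub_zero]
    · have e : (rI ≫ biprod.inl + rI' ≫ biprod.inr) ≫ (biprod.snd : F ⊞ F' ⟶ F') = rI' := by
        simp
      refine (congrArg (fun f : K ⟶ F' => f.app V (k.app V (a - x))) e).trans ?_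
      refine (congrArg (fun f : structureModule X ⟶ F' => f.app V (a - x)) hrI').trans ?_
      have : a - x = b + y := by rw [sub_eq_iff_eq_add, add_assoc, add_comm y x, hxy]; abel
      rw [this, map_add, hb, hy, add_zero]
  mono_f := Modules.mono_of_affine fun V hV s hs => by
    obtain ⟨a, rfl⟩ := hk.surjective ⟨V, hV⟩ s
    refine (hk.app_eq_zero_iff ⟨V, hV⟩ a).2 ⟨?_, ?_⟩
    · refine (h.app_eq_zero_iff ⟨V, hV⟩ a).1 ?_
      have e : k ≫ (rI ≫ biprod.inl + rI' ≫ biprod.inr) ≫ (biprod.fst : F ⊞ F' ⟶ F) = q := by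
        simpa using hrI
      refine (congrArg (fun f : structureModule X ⟶ F => f.app V a) e.symm).trans ?_
      exact (congrArg ((biprod.fst : F ⊞ F' ⟶ F).app V) hs).trans (map_zero _)
    · refine (h'.app_eq_zero_iff ⟨V, hV⟩ a).1 ?_
      have e : k ≫ (rI ≫ biprod.inl + rI' ≫ biprod.inr) ≫ (biprod.snd : F ⊞ F' ⟶ F') = q' := by
        simpa using hrI'
      refine (congrArg (fun f : structureModule X ⟶ F' => f.app V a) e.symm).trans ?_
      exact (congrArg ((biprod.snd : F ⊞ F' ⟶ F').app V) hs).trans (map_zero _)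
  epi_g := by
    have := hl.epi
    have e : (q ≫ biprod.inl) ≫ (biprod.fst ≫ rL - biprod.snd ≫ rL') = l := by simpa using hrL
    rw [← e] at this
    exact epi_of_epi (q ≫ biprod.inl) (biprod.fst ≫ rL - biprod.snd ≫ rL')

theorem IsQuotientBy.isZero (h : IsQuotientBy q ⊤) : IsZero F := by
  have := h.epi
  have : q = 0 := Modules.hom_ext_of_affine fun V hV s =>
    (h.app_eq_zero_iff ⟨V, hV⟩ s).2 trivial
  rw [IsZero.iff_id_eq_zero, ← cancel_epi q, this, zero_comp, zero_comp]

end Quotient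
end

noncomputable section

/-! ### Coherence -/

section Coherence

open Scheme Limits

variable {X : Scheme.{u}}

/-- The maps `g i : 𝒪_X → M` generate `M`, in the form that they are jointly epimorphic. -/
def Generates {M : X.Modules} {n : Type*} (g : n → (structureModule X ⟶ M)) : Prop :=
  ∀ ⦃Z : X.Modules⦄ ⦃a b : M ⟶ Z⦄, (∀ i, g i ≫ a = g i ≫ b) → a = b

section Generates

variable {F F' : X.Modules} (q : structureModule X ⟶ F) (q' : structureModule X ⟶ F')

theorem generates_of_epi [Epi q] : Generates fun _ : Unit => q :=
  fun _ _ _ h => (cancel_epi q).1 (h ())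

theorem generates_biprod [Epi q] [Epi q'] :
    Generates (fun b : Bool => bif b then q ≫ biprod.inl else q' ≫ biprod.inr :
      Bool → (structureModule X ⟶ F ⊞ F')) := fun Z a b h => by
  refine biprod.hom_ext' _ _ ?_ ?_
  · simpa [cancel_epi] using h true
  · simpa [cancel_epi] using h false

end Generates

theorem Generates.isFiniteType {M : X.Modules} {n : Type} [Finite n]
    {g : n → (structureModule X ⟶ M)} (hg : Generates g) :
    SheafOfModules.IsFiniteType.{u} (R := X.ringCatSheaf) M := by
  let σ : SheafOfModules.GeneratingSections (R := X.ringCatSheaf) M :=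
    { I := ULift.{u} n
      s := fun i => SheafOfModules.unitHomEquiv (R := X.ringCatSheaf) M (g i.down)
      epi := by
        refine Epi.mk (C := SheafOfModules X.ringCatSheaf) fun {Z} a b hab =>
          hg (Z := Z) fun i => ?_
        have h : SheafOfModules.ιFree (ULift.up i) ≫
            (SheafOfModules.freeHomEquiv (R := X.ringCatSheaf) M).symm
              (fun i : ULift n =>
                SheafOfModules.unitHomEquiv (R := X.ringCatSheaf) M (g i.down)) = g i :=
          (SheafOfModules.unitHomEquiv (R := X.ringCatSheaf) M).injective
            (congrFun ((SheafOfModules.freeHomEquiv (R := X.ringCatSheaf) M).apply_symm_apply _)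
              (ULift.up i))
        rw [← h]
        exact (Category.assoc _ _ _).trans ((congrArg (SheafOfModules.ιFree (ULift.up i) ≫ ·)
          hab).trans (Category.assoc _ _ _).symm) }
  constructor
  refine ⟨σ.localGeneratorsData, ?_⟩
  constructor
  intro i
  constructor
  exact inferInstanceAs (Finite (ULift n))

/-- Transport of a presentation along an isomorphism. -/
def presentationOfIso {M N : X.Modules} (e : M ≅ N)
    (P : SheafOfModules.Presentation (R := X.ringCatSheaf) M) :
    SheafOfModules.Presentation (R := X.ringCatSheaf) N :=
  have : IsIso (C := SheafOfModules X.ringCatSheaf) e.hom :=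
    ⟨e.inv, e.hom_inv_id, e.inv_hom_id⟩
  SheafOfModules.Presentation.ofIsIso (R := X.ringCatSheaf) e.hom P

/-- Quasi-coherence from presentations over the members of an open cover. -/
theorem isQuasicoherent_of_presentation {M : X.Modules} {ι : Type u} (U : ι → X.Opens)
    (hU : ⨆ i, U i = ⊤)
    (h : ∀ i, Nonempty (SheafOfModules.Presentation (M.restrict (U i).ι))) :
    SheafOfModules.IsQuasicoherent (R := X.ringCatSheaf) M := by
  have P := fun i => (h i).some
  have hc : (Opens.grothendieckTopology X).CoversTop U := by
    rw [Opens.coversTop_iff]; exact hU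
  suffices h : ∀ i, Nonempty (SheafOfModules.Presentation
      (SheafOfModules.over (R := X.ringCatSheaf) M (U i))) by
    constructor
    constructor
    exact { I := ι, X := U, coversTop := hc, presentation := fun i => (h i).some }
  intro i
  let e : SheafOfModules (X.ringCatSheaf.over (U i)) ≌
    SheafOfModules (U i).toScheme.ringCatSheaf := Modules.overEquiv (U i)
  let e1 : e.functor.obj (SheafOfModules.over (R := X.ringCatSheaf) M (U i)) ≅
      M.restrict (U i).ι :=
    (Modules.overFunctorEquiv (U i)).app M
  let P' := presentationOfIso e1.symm (P i)
  have : PreservesColimitsOfSize.{u, u} e.inverse :=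
    e.symm.toAdjunction.leftAdjoint_preservesColimits
  let P'' := SheafOfModules.Presentation.map P' e.inverse (e.unitIso.app (SheafOfModules.unit _))
  let e2 := (e.unitIso.app (SheafOfModules.over (R := X.ringCatSheaf) M (U i)))
  have : IsIso e2.inv := inferInstance
  exact ⟨P''.ofIsIso e2.inv⟩

theorem essImage_biprod {R : CommRingCat.{u}} {M N : (Spec R).Modules}
    (hM : (tilde.functor R).essImage M) (hN : (tilde.functor R).essImage N) :
    (tilde.functor R).essImage (M ⊞ N) := by
  obtain ⟨A, ⟨e⟩⟩ := hM
  obtain ⟨B, ⟨e'⟩⟩ := hN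
  have := preservesBinaryBiproducts_of_preservesBinaryCoproducts (tilde.functor R)
  exact ⟨A ⊞ B, ⟨(tilde.functor R).mapBiprod A B ≪≫ biprod.mapIso e e'⟩⟩

/-- A sheaf of modules is quasi-coherent if its restriction to every affine open is associated to
a module. -/
theorem isQuasicoherent_of_essImage {M : X.Modules}
    (h : ∀ (U : X.Opens) (hU : IsAffineOpen U),
      (tilde.functor Γ(X, U)).essImage (M.restrict hU.fromSpec)) :
    SheafOfModules.IsQuasicoherent (R := X.ringCatSheaf) M := by
  refine isQuasicoherent_of_presentation (fun U : X.affineOpens => U.1)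
    (iSup_affineOpens_eq_top X) fun U => ?_
  have hU : IsAffineOpen U.1 := U.2
  obtain ⟨N, ⟨e⟩⟩ := h U.1 hU
  let P := presentationTilde N .univ (by simp) _ (Submodule.span_eq _)
  let P' : SheafOfModules.Presentation (M.restrict hU.fromSpec) := presentationOfIso e P
  let P'' := Modules.presentationRestrict hU.isoSpec.hom P'
  have e1 : hU.isoSpec.hom ≫ hU.fromSpec = U.1.ι := hU.isoSpec_hom_fromSpec
  let e2 : (M.restrict hU.fromSpec).restrict hU.isoSpec.hom ≅ M.restrict U.1.ι :=
    (Modules.restrictFunctorComp hU.isoSpec.hom hU.fromSpec).symm.app M ≪≫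
      (Modules.restrictFunctorCongr e1).app M
  exact ⟨presentationOfIso e2 P''⟩

theorem essImage_restrict {M : X.Modules}
    (h : SheafOfModules.IsQuasicoherent (R := X.ringCatSheaf) M) {U : X.Opens}
    (hU : IsAffineOpen U) : (tilde.functor Γ(X, U)).essImage (M.restrict hU.fromSpec) := by
  have : SheafOfModules.IsQuasicoherent (R := (Spec Γ(X, U)).ringCatSheaf)
    (M.restrict hU.fromSpec) := Modules.isQuasicoherent_restrictFunctor hU.fromSpec M
  rw [← isIso_fromTildeΓ_iff]
  exact Modules.isIso_fromTildeΓ_of_isQuasicoherent _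

theorem isQuasicoherent_biprod {M N : X.Modules}
    (hM : SheafOfModules.IsQuasicoherent (R := X.ringCatSheaf) M)
    (hN : SheafOfModules.IsQuasicoherent (R := X.ringCatSheaf) N) :
    SheafOfModules.IsQuasicoherent (R := X.ringCatSheaf) (M ⊞ N : X.Modules) := by
  refine isQuasicoherent_of_essImage fun U hU => ?_
  have := preservesBinaryBiproducts_of_preservesBinaryCoproducts
    (Modules.restrictFunctor hU.fromSpec)
  have : HasBinaryBiproduct (C := X.Modules) M N := inferInstance
  exact (Functor.essImage _).prop_of_iso
    (Functor.mapBiprod (C := X.Modules) (Modules.restrictFunctor hU.fromSpec) M N).symm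
    (essImage_biprod (essImage_restrict hM hU) (essImage_restrict hN hU))

/-- Over an affine open `U`, the structure sheaf of the closed subscheme is the pushforward of the
structure sheaf along `Spec Γ(X, U)/I(U) → Spec Γ(X, U)`. -/
theorem isQuasicoherent_closedStructureModule (I : X.IdealSheafData) :
    SheafOfModules.IsQuasicoherent (R := X.ringCatSheaf) (closedStructureModule I) := by
  refine isQuasicoherent_of_essImage fun U hU => ?_
  let c := I.subschemeCover.f ⟨U, hU⟩
  have : IsOpenImmersion c := I.subschemeCover.map_prop _
  let φ : Γ(X, U) ⟶ CommRingCat.of (Γ(X, U) ⧸ I.ideal ⟨U, hU⟩) :=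
    CommRingCat.ofHom (Ideal.Quotient.mk (I.ideal ⟨U, hU⟩))
  have hc : c ≫ I.subschemeι = Spec.map φ ≫ hU.fromSpec :=
    (Scheme.IdealSheafData.subschemeCover_map_subschemeι I ⟨U, hU⟩).trans
      (Scheme.IdealSheafData.glueDataObjι_ι I ⟨U, hU⟩)
  let m : (closedStructureModule I).restrict hU.fromSpec ⟶
      ((Modules.pushforward I.subschemeι).obj ((Modules.pushforward c).obj
        (structureModule _))).restrict hU.fromSpec :=
    (Modules.restrictFunctor hU.fromSpec).map ((Modules.pushforward I.subschemeι).map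
      (comorphism c))
  have hm : IsIso m := by
    rw [Modules.Hom.isIso_iff_isIso_app]
    intro V
    have : IsIso (c.app (I.subschemeι ⁻¹ᵁ (hU.fromSpec ''ᵁ V))) := by
      refine Scheme.Hom.isIso_app c _ ?_
      exact (I.opensRange_subschemeCover_map ⟨U, hU⟩).ge.trans' (I.subschemeι.preimage_mono
        ((hU.fromSpec.image_le_opensRange V).trans_eq hU.opensRange_fromSpec))
    rw [ConcreteCategory.isIso_iff_bijective]
    exact ConcreteCategory.bijective_of_isIso (c.app (I.subschemeι ⁻¹ᵁ (hU.fromSpec ''ᵁ V)))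
  let e : (closedStructureModule I).restrict hU.fromSpec ≅
      (Modules.pushforward (Spec.map φ)).obj (structureModule _) :=
    asIso m ≪≫ (Modules.restrictFunctor hU.fromSpec).mapIso
      ((Modules.pushforwardComp c I.subschemeι).app _ ≪≫
        (Modules.pushforwardCongr hc).app _ ≪≫
        (Modules.pushforwardComp (Spec.map φ) hU.fromSpec).symm.app _) ≪≫
      (Modules.restrictFunctorAdjCounitIso hU.fromSpec).app _
  refine (Functor.essImage _).prop_of_iso e.symm ?_
  rw [← isIso_fromTildeΓ_iff]
  have := isIso_fromTildeΓ_iff.mpr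
    ⟨_, ⟨tildeSelf (R := CommRingCat.of (Γ(X, U) ⧸ I.ideal ⟨U, hU⟩))⟩⟩
  exact @isIso_fromTildeΓ_pushforward _ _ φ _ this

theorem IsQuotientBy.isIso {F : X.Modules} {q : structureModule X ⟶ F} (h : IsQuotientBy q ⊥) :
    IsIso q := by
  have := h.epi
  have : Mono q := Modules.mono_of_affine fun V hV s hs => (h.app_eq_zero_iff ⟨V, hV⟩ s).1 hs
  exact isIso_of_mono_of_epi q

theorem isCoherentModule_closedStructureModule (I : X.IdealSheafData) :
    IsCoherentModule (closedStructureModule I) where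
  isQuasicoherent := isQuasicoherent_closedStructureModule I
  isFiniteType :=
    have := (isQuotientBy_comorphism I).epi
    (generates_of_epi (F := closedStructureModule I) (comorphism I.subschemeι)).isFiniteType

theorem isCoherentModule_structureModule : IsCoherentModule (structureModule X) where
  isQuasicoherent := by
    have := (isQuotientBy_comorphism (⊥ : X.IdealSheafData)).isIso
    refine ObjectProperty.prop_of_iso (SheafOfModules.isQuasicoherent X.ringCatSheaf)
      (X := closedStructureModule (⊥ : X.IdealSheafData)) (Y := structureModule X) ?_
      (isQuasicoherent_closedStructureModule ⊥)
    exact (asIso (C := X.Modules) (Y := closedStructureModule (⊥ : X.IdealSheafData))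
      (comorphism (⊥ : X.IdealSheafData).subschemeι)).symm
  isFiniteType := (generates_of_epi (𝟙 (structureModule X))).isFiniteType

theorem IsCoherentModule.biprod {F F' : X.Modules} (hF : IsCoherentModule F)
    (hF' : IsCoherentModule F') (q : structureModule X ⟶ F) (q' : structureModule X ⟶ F')
    [Epi q] [Epi q'] : IsCoherentModule (F ⊞ F') where
  isQuasicoherent := isQuasicoherent_biprod hF.isQuasicoherent hF'.isQuasicoherent
  isFiniteType := (generates_biprod q q').isFiniteType

end Coherence
end

noncomputable section

/-! ### Pullbacks of quotients of the structure sheaf -/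

section Pullback

open Scheme Limits

/-- Adjuncts with respect to two adjunctions that are related by a morphism of left adjoints. -/
theorem homEquiv_conjugateEquiv_app {C D : Type*} [Category* C] [Category* D] {L₁ L₂ : C ⥤ D}
    {R₁ R₂ : D ⥤ C} (adj₁ : L₁ ⊣ R₁) (adj₂ : L₂ ⊣ R₂) (α : L₂ ⟶ L₁) {c : C} {d : D}
    (g : L₁.obj c ⟶ d) :
    adj₂.homEquiv c d (α.app c ≫ g) =
      adj₁.homEquiv c d g ≫ (conjugateEquiv adj₁ adj₂ α).app d := by
  simp only [Adjunction.homEquiv_unit, Functor.map_comp, Category.assoc]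
  rw [NatTrans.naturality]
  exact ((Category.assoc _ _ _).symm.trans
    (congrArg (· ≫ R₂.map g) (unit_conjugateEquiv adj₁ adj₂ α c).symm)).trans (Category.assoc _ _ _)

variable {T Y X : Scheme.{u}}

theorem homEquiv_pullbackStructure (f : Y ⟶ X) :
    (Modules.pullbackPushforwardAdjunction f).homEquiv _ _ (pullbackStructure f) =
      comorphism f :=
  Equiv.apply_symm_apply _ _

/-- Both sides are adjunct to the comorphism of `t ≫ p`. -/
theorem pullbackStructure_comp (t : T ⟶ Y) (p : Y ⟶ X) :
    pullbackStructure (t ≫ p) = (Modules.pullbackComp t p).inv.app (structureModule X) ≫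
      (Modules.pullback t).map (pullbackStructure p) ≫ pullbackStructure t := by
  refine ((Modules.pullbackPushforwardAdjunction (t ≫ p)).homEquiv _ _).injective ?_
  rw [homEquiv_conjugateEquiv_app ((Modules.pullbackPushforwardAdjunction p).comp
    (Modules.pullbackPushforwardAdjunction t)), Modules.conjugateEquiv_pullbackComp_inv,
    homEquiv_pullbackStructure, Adjunction.comp_homEquiv]
  have h : (Modules.pullbackPushforwardAdjunction t).homEquiv _ _
      ((Modules.pullback t).map (pullbackStructure p) ≫ pullbackStructure t) =
        pullbackStructure p ≫ comorphism t := by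
    rw [Adjunction.homEquiv_naturality_left, homEquiv_pullbackStructure]
  have h' : (Modules.pullbackPushforwardAdjunction p).homEquiv _ _
      (pullbackStructure p ≫ comorphism t) =
        comorphism p ≫ (Modules.pushforward p).map (comorphism t) := by
    rw [Adjunction.homEquiv_naturality_right, homEquiv_pullbackStructure]
  have e : comorphism (t ≫ p) = (comorphism p ≫ (Modules.pushforward p).map (comorphism t)) ≫
      (Modules.pushforwardComp t p).hom.app _ := rfl
  rw [e, ← h', ← h]
  rfl

theorem pullbackCongr_hom_app_structureModule {f g : Y ⟶ X} (h : f = g) :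
    (Modules.pullbackCongr h).hom.app (structureModule X) =
      pullbackStructure f ≫ inv (pullbackStructure g) := by
  subst h
  rw [IsIso.hom_inv_id]
  rfl

variable {p a : Y ⟶ X}

/-- The canonical comparison for the structure sheaf is stable under pullback. -/
theorem pullbackHom_structureModule (t : T ⟶ Y) :
    pullbackHom (pullbackStructure p ≫ inv (pullbackStructure a)) t =
      pullbackStructure (t ≫ p) ≫ inv (pullbackStructure (t ≫ a)) := by
  rw [← cancel_mono (pullbackStructure (t ≫ a)), Category.assoc, IsIso.inv_hom_id,
    Category.comp_id, pullbackStructure_comp t p, pullbackStructure_comp t a]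
  simp [pullbackHom]

theorem pullbackHom_naturality {E F : X.Modules} {g : E ⟶ F}
    {φ : (Modules.pullback p).obj E ⟶ (Modules.pullback a).obj E}
    {ψ : (Modules.pullback p).obj F ⟶ (Modules.pullback a).obj F}
    (h : (Modules.pullback p).map g ≫ ψ = φ ≫ (Modules.pullback a).map g) (t : T ⟶ Y) :
    (Modules.pullback (t ≫ p)).map g ≫ pullbackHom ψ t =
      pullbackHom φ t ≫ (Modules.pullback (t ≫ a)).map g := by
  have h' := congrArg (Modules.pullback t).map h
  simp only [Functor.map_comp] at h'
  simp only [pullbackHom, Category.assoc]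
  have e1 := (Modules.pullbackComp t p).inv.naturality g
  have e2 := (Modules.pullbackComp t a).hom.naturality g
  simp only [Functor.comp_map] at e1 e2
  rw [reassoc_of% e1, ← e2, reassoc_of% h']

/-- The comparison `p^* 𝒪_X ≅ 𝒪_Y ≅ a^* 𝒪_X` descends to the quotient by an ideal sheaf `I` if
`p⁻¹ I` is contained in `a⁻¹ I`. -/
theorem IsQuotientBy.exists_pullback_hom {F : X.Modules} {q : structureModule X ⟶ F}
    {I : X.IdealSheafData} (h : IsQuotientBy q I) (hI : I.comap p ≤ I.comap a) :
    ∃ φ : (Modules.pullback p).obj F ⟶ (Modules.pullback a).obj F,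
      (Modules.pullback p).map q ≫ φ =
        (pullbackStructure p ≫ inv (pullbackStructure a)) ≫ (Modules.pullback a).map q := by
  have := h.epi
  let ω : structureModule Y ⟶ (Modules.pullback a).obj F :=
    inv (pullbackStructure a) ≫ (Modules.pullback a).map q
  let adj := Modules.pullbackPushforwardAdjunction p
  have hω : comorphism a ≫ (Modules.pushforward a).map ω =
      q ≫ (Modules.pullbackPushforwardAdjunction a).unit.app F := by
    rw [← homEquiv_pullbackStructure, ← Adjunction.homEquiv_naturality_right]
    simp [ω, Adjunction.homEquiv_unit]
  -- `ω` kills the sections of `a⁻¹ I`, hence those of `p⁻¹ I`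
  have hker {V : X.Opens} (hV : IsAffineOpen V) {W : Y.Opens} (hW : IsAffineOpen W)
      (e : W ≤ a ⁻¹ᵁ V) (x : Γ(Y, W)) (hx : x ∈ (I.comap a).ideal ⟨W, hW⟩) :
      ω.app W x = 0 := by
    rw [ideal_comap I a hV hW e] at hx
    refine Submodule.span_induction ?_ (map_zero _) ?_ ?_ hx
    · rintro _ ⟨f, hf, rfl⟩
      have h0 : ω.app (a ⁻¹ᵁ V) (a.app V f) = 0 := by
        refine (congrArg (fun g : structureModule X ⟶ _ => g.app V f) hω).trans ?_
        refine (congrArg (((Modules.pullbackPushforwardAdjunction a).unit.app F).app V)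
          ((h.app_eq_zero_iff ⟨V, hV⟩ f).2 hf)).trans (map_zero _)
      have h1 := Modules.app_map ω e (a.app V f)
      rw [h0, map_zero] at h1
      exact h1
    · intro x y _ _ hx hy
      exact (map_add _ _ _).trans (by rw [hx, hy, add_zero])
    · intro c x _ hx
      exact (Modules.Hom.app_smul ω c x).trans (by rw [hx, smul_zero])
  -- so the adjunct of the map to be factored kills the kernel of `q`
  have w : kernel.ι q ≫ comorphism p ≫ (Modules.pushforward p).map ω = 0 := by
    refine Modules.hom_ext_of_affine fun V hV s => ?_
    have hf : (kernel.ι q).app V s ∈ I.ideal ⟨V, hV⟩ :=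
      (h.app_eq_zero_iff ⟨V, hV⟩ _).1
        (congrArg (fun f => Modules.Hom.app f V s) (kernel.condition q))
    change ω.app (p ⁻¹ᵁ V) (p.app V ((kernel.ι q).app V s)) = 0
    generalize (kernel.ι q).app V s = f at hf
    refine Modules.section_ext_of_local fun y hy => ?_
    obtain ⟨V', hV', -, hyV'⟩ := exists_affine_mem_le (Opens.mem_top (a y))
    obtain ⟨W, hW, hWle, hyW⟩ := exists_affine_mem_le (U := p ⁻¹ᵁ V ⊓ a ⁻¹ᵁ V') ⟨hy, hyV'⟩
    refine ⟨W, hWle.trans inf_le_left, hyW, ?_⟩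
    refine ((Modules.app_map ω (hWle.trans inf_le_left) _).symm.trans ?_).trans (map_zero _).symm
    refine hker hV' hW (hWle.trans inf_le_right) _ (hI ⟨W, hW⟩ ?_)
    rw [ideal_comap I p hV hW (hWle.trans inf_le_left)]
    exact Ideal.mem_map_of_mem _ hf
  refine ⟨(adj.homEquiv _ _).symm (Abelian.epiDesc q _ w), ?_⟩
  refine (adj.homEquiv _ _).injective ?_
  rw [Adjunction.homEquiv_naturality_left, Equiv.apply_symm_apply, Abelian.comp_epiDesc,
    ← homEquiv_pullbackStructure, ← Adjunction.homEquiv_naturality_right, Category.assoc]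

end Pullback
end

noncomputable section

/-! ### Equivariant structures on quotients of the structure sheaf -/

section EquivariantQuotient

open Scheme Limits

variable {S : Scheme.{u}} {G : Over S} [GrpObj G] {X : Scheme.{u}} {s : X ⟶ S}
  [ModObj G (Over.mk s)]

theorem structureIso_hom : (structureIso G s).hom =
    pullbackStructure (projMap G s) ≫ inv (pullbackStructure (actMap G s)) := rfl

/-- All maps in the cocycle condition are composites of canonical maps to structure sheaves. -/
theorem structureIso_cocycle : pullbackHom (structureIso G s).hom (mulMap₂ G s) =
    (Modules.pullbackCongr (mulMap₂_projMap G s)).hom.app (structureModule X) ≫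
      pullbackHom (structureIso G s).hom (projMap₂ G s) ≫
      (Modules.pullbackCongr (projMap₂_actMap G s)).hom.app (structureModule X) ≫
      pullbackHom (structureIso G s).hom (actMap₂ G s) ≫
      (Modules.pullbackCongr (actMap₂_actMap G s)).hom.app (structureModule X) := by
  simp only [structureIso_hom, pullbackHom_structureModule, pullbackCongr_hom_app_structureModule,
    Category.assoc, IsIso.inv_hom_id_assoc]

/-- The pullback is a left adjoint, so it preserves generators. -/
theorem Generates.pullback {M : X.Modules} {n : Type*} {g : n → (structureModule X ⟶ M)}
    (hg : Generates g) {Y : Scheme.{u}} (f : Y ⟶ X) {Z : Y.Modules}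
    {a b : (Modules.pullback f).obj M ⟶ Z}
    (h : ∀ i, (Modules.pullback f).map (g i) ≫ a = (Modules.pullback f).map (g i) ≫ b) :
    a = b := by
  refine ((Modules.pullbackPushforwardAdjunction f).homEquiv _ _).injective (hg fun i => ?_)
  rw [← Adjunction.homEquiv_naturality_left, ← Adjunction.homEquiv_naturality_left, h]

/-- Both the invertibility and the cocycle condition can be checked on generators, where they hold
because they hold for the structure sheaf. -/
theorem Generates.exists_equivariantStructure {M : X.Modules} {n : Type*}
    {g : n → (structureModule X ⟶ M)} (hg : Generates g)
    {φ : (Modules.pullback (projMap G s)).obj M ⟶ (Modules.pullback (actMap G s)).obj M}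
    {ψ : (Modules.pullback (actMap G s)).obj M ⟶ (Modules.pullback (projMap G s)).obj M}
    (hφ : ∀ i, (Modules.pullback (projMap G s)).map (g i) ≫ φ =
      (structureIso G s).hom ≫ (Modules.pullback (actMap G s)).map (g i))
    (hψ : ∀ i, (Modules.pullback (actMap G s)).map (g i) ≫ ψ =
      (structureIso G s).inv ≫ (Modules.pullback (projMap G s)).map (g i)) :
    ∃ Φ : EquivariantStructure G s M, Φ.iso.hom = φ := by
  refine ⟨⟨⟨φ, ψ, hg.pullback _ fun i => ?_, hg.pullback _ fun i => ?_⟩,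
    hg.pullback _ fun i => ?_⟩, rfl⟩
  · rw [reassoc_of% hφ i, hψ i, Iso.hom_inv_id_assoc, Category.comp_id]
  · rw [reassoc_of% hψ i, hφ i, Iso.inv_hom_id_assoc, Category.comp_id]
  · have e (t : actSource₂ G s ⟶ actSource G s) := pullbackHom_naturality (hφ i) t
    have e1 := (Modules.pullbackCongr (mulMap₂_projMap G s)).hom.naturality (g i)
    have e2 := (Modules.pullbackCongr (projMap₂_actMap G s)).hom.naturality (g i)
    have e3 := (Modules.pullbackCongr (actMap₂_actMap G s)).hom.naturality (g i)
    rw [e, structureIso_cocycle, reassoc_of% e1, reassoc_of% e (projMap₂ G s), reassoc_of% e2,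
      reassoc_of% e (actMap₂ G s), e3]
    simp only [Category.assoc]

variable {F F' : X.Modules} {q : structureModule X ⟶ F} {q' : structureModule X ⟶ F'}
  {I I' : X.IdealSheafData}

theorem exists_equivariantStructure_structureModule :
    ∃ φ : EquivariantStructure G s (structureModule X), φ.iso = structureIso G s := by
  obtain ⟨Φ, hΦ⟩ := (generates_of_epi (𝟙 (structureModule X))).exists_equivariantStructure
    (G := G) (s := s) (φ := (structureIso G s).hom) (ψ := (structureIso G s).inv)
    (by simp) (by simp)
  exact ⟨Φ, Iso.ext hΦ⟩

theorem IsQuotientBy.exists_equivariantStructure (h : IsQuotientBy q I)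
    (hI : I.comap (projMap G s) = I.comap (actMap G s)) :
    ∃ φ : EquivariantStructure G s F, φ.IsCanonical q := by
  obtain ⟨φ, hφ⟩ := h.exists_pullback_hom hI.le
  obtain ⟨ψ, hψ⟩ := h.exists_pullback_hom hI.ge
  have := h.epi
  obtain ⟨Φ, rfl⟩ := (generates_of_epi q).exists_equivariantStructure (G := G) (s := s)
    (fun _ => hφ) (fun _ => hψ)
  exact ⟨Φ, hφ⟩

theorem EquivariantStructure.IsCanonical.exists_biprod [Epi q] [Epi q']
    {φ : EquivariantStructure G s F} {φ' : EquivariantStructure G s F'}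
    (h : φ.IsCanonical q) (h' : φ'.IsCanonical q') :
    ∃ Φ : EquivariantStructure G s (F ⊞ F'),
      Φ.IsCanonical (q ≫ biprod.inl) ∧ Φ.IsCanonical (q' ≫ biprod.inr) := by
  have key {Y : Scheme.{u}} {f g : Y ⟶ X}
      (α : (Modules.pullback f).obj F ⟶ (Modules.pullback g).obj F)
      (α' : (Modules.pullback f).obj F' ⟶ (Modules.pullback g).obj F') :
      ∃ β : (Modules.pullback f).obj (F ⊞ F') ⟶ (Modules.pullback g).obj (F ⊞ F'),
        (Modules.pullback f).map biprod.inl ≫ β = α ≫ (Modules.pullback g).map biprod.inl ∧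
        (Modules.pullback f).map biprod.inr ≫ β = α' ≫ (Modules.pullback g).map biprod.inr := by
    refine ⟨(Modules.pullback f).map biprod.fst ≫ α ≫ (Modules.pullback g).map biprod.inl +
      (Modules.pullback f).map biprod.snd ≫ α' ≫ (Modules.pullback g).map biprod.inr, ?_, ?_⟩ <;>
    simp [← Functor.map_comp_assoc]
  obtain ⟨β, h₁, h₂⟩ := key φ.iso.hom φ'.iso.hom
  obtain ⟨γ, h₃, h₄⟩ := key φ.iso.inv φ'.iso.inv
  have e : (Modules.pullback (actMap G s)).map q ≫ φ.iso.inv =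
      (structureIso G s).inv ≫ (Modules.pullback (projMap G s)).map q := by
    rw [Iso.comp_inv_eq, Category.assoc, Iso.eq_inv_comp]
    exact h.symm
  have e' : (Modules.pullback (actMap G s)).map q' ≫ φ'.iso.inv =
      (structureIso G s).inv ≫ (Modules.pullback (projMap G s)).map q' := by
    rw [Iso.comp_inv_eq, Category.assoc, Iso.eq_inv_comp]
    exact h'.symm
  have H : (Modules.pullback (projMap G s)).map (q ≫ biprod.inl) ≫ β =
      (structureIso G s).hom ≫ (Modules.pullback (actMap G s)).map (q ≫ biprod.inl) := by
    unfold EquivariantStructure.IsCanonical at h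
    rw [Functor.map_comp, Category.assoc, h₁, reassoc_of% h, Functor.map_comp]
  have H' : (Modules.pullback (projMap G s)).map (q' ≫ biprod.inr) ≫ β =
      (structureIso G s).hom ≫ (Modules.pullback (actMap G s)).map (q' ≫ biprod.inr) := by
    unfold EquivariantStructure.IsCanonical at h'
    rw [Functor.map_comp, Category.assoc, h₂, reassoc_of% h', Functor.map_comp]
  obtain ⟨Φ, rfl⟩ := (generates_biprod q q').exists_equivariantStructure
    (G := G) (s := s) (φ := β) (ψ := γ)
    (by rintro (_ | _); exacts [H', H])
    (by
      rintro (_ | _)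
      · change (Modules.pullback (actMap G s)).map (q' ≫ biprod.inr) ≫ γ =
          (structureIso G s).inv ≫ (Modules.pullback (projMap G s)).map (q' ≫ biprod.inr)
        rw [Functor.map_comp, Category.assoc, h₄, reassoc_of% e', Functor.map_comp]
      · change (Modules.pullback (actMap G s)).map (q ≫ biprod.inl) ≫ γ =
          (structureIso G s).inv ≫ (Modules.pullback (projMap G s)).map (q ≫ biprod.inl)
        rw [Functor.map_comp, Category.assoc, h₃, reassoc_of% e, Functor.map_comp])
  exact ⟨Φ, H, H'⟩

variable {φ : EquivariantStructure G s F} {π π' : structureModule X ⟶ F}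

theorem EquivariantStructure.IsCanonical.add (h : φ.IsCanonical π) (h' : φ.IsCanonical π') :
    φ.IsCanonical (π + π') := by
  unfold EquivariantStructure.IsCanonical at *
  simp [Functor.map_add, h, h']

theorem EquivariantStructure.IsCanonical.neg (h : φ.IsCanonical π) : φ.IsCanonical (-π) := by
  unfold EquivariantStructure.IsCanonical at *
  simp [Functor.map_neg, h]

theorem EquivariantStructure.isCanonical_zero : φ.IsCanonical 0 := by
  unfold EquivariantStructure.IsCanonical
  simp

theorem Generates.isEquivariantHom {E F : EquivariantCoherentModule G s} {n : Type*}
    {g : n → (structureModule X ⟶ E.sheaf)} (hg : Generates g)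
    (h : ∀ i, E.equivariant.IsCanonical (g i)) {f : E.sheaf ⟶ F.sheaf}
    (hf : ∀ i, F.equivariant.IsCanonical (g i ≫ f)) : IsEquivariantHom f := by
  refine hg.pullback _ fun i => ?_
  have h1 := hf i
  have h2 := h i
  unfold EquivariantStructure.IsCanonical at h1 h2
  rw [reassoc_of% h2, ← Functor.map_comp, ← h1, Functor.map_comp, Category.assoc]

end EquivariantQuotient
end

noncomputable section

/-! ### Classes of closed subschemes in equivariant `K`-homology -/

section Classes

open Scheme Limits

variable {S : Scheme.{u}} {G : Over S} [GrpObj G] {X : Scheme.{u}} {s : X ⟶ S}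
  [ModObj G (Over.mk s)]

/-- The defining relation of equivariant `K`-homology. -/
theorem mk_eq_add_of_shortExact {F₁ F₂ F₃ : EquivariantCoherentModule G s}
    {i : F₁.sheaf ⟶ F₂.sheaf} {q : F₂.sheaf ⟶ F₃.sheaf} (w : i ≫ q = 0) (hi : IsEquivariantHom i)
    (hq : IsEquivariantHom q) (h : (ShortComplex.mk i q w).ShortExact) :
    (QuotientAddGroup.mk (.of F₂) : EquivariantKHomology G s) =
      QuotientAddGroup.mk (.of F₁) + QuotientAddGroup.mk (.of F₃) := by
  have h0 : (FreeAbelianGroup.of F₂ - .of F₁ - .of F₃) ∈ equivariantKRelations G s :=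
    AddSubgroup.subset_closure ⟨F₁, F₂, F₃, i, q, w, hi, hq, h, rfl⟩
  have h1 := (QuotientAddGroup.eq_zero_iff _).2 h0
  rw [sub_sub, QuotientAddGroup.mk_sub, sub_eq_zero] at h1
  exact h1

theorem equivariantKClass_eq_zero {F : X.Modules} (hF : IsCoherentModule F)
    (φ : EquivariantStructure G s F) (h : IsZero F) :
    (equivariantKClass hF φ : EquivariantKHomology G s) = 0 := by
  have hm : Mono (0 : F ⟶ F) := ⟨fun _ _ _ => h.eq_of_tgt _ _⟩
  have he : Epi (0 : F ⟶ F) := ⟨fun _ _ _ => h.eq_of_src _ _⟩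
  have := mk_eq_add_of_shortExact (F₁ := ⟨F, hF, φ⟩) (F₂ := ⟨F, hF, φ⟩) (F₃ := ⟨F, hF, φ⟩)
    (i := (0 : F ⟶ F)) (q := (0 : F ⟶ F)) zero_comp (by simp [IsEquivariantHom])
    (by simp [IsEquivariantHom])
    { exact := ShortComplex.exact_of_isZero_X₂ _ h, mono_f := hm, epi_g := he }
  simpa [equivariantKClass] using this

variable {I J : X.IdealSheafData}

/-- A choice of equivariant structure on the structure sheaf of an invariant closed subscheme. -/
def closedEquivariantStructure (hI : I.comap (projMap G s) = I.comap (actMap G s)) :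
    EquivariantStructure G s (closedStructureModule I) :=
  ((isQuotientBy_comorphism I).exists_equivariantStructure hI).choose

theorem isCanonical_closedEquivariantStructure
    (hI : I.comap (projMap G s) = I.comap (actMap G s)) :
    (closedEquivariantStructure hI).IsCanonical (comorphism I.subschemeι) :=
  ((isQuotientBy_comorphism I).exists_equivariantStructure hI).choose_spec

/-- The class of an invariant closed subscheme. -/
def closedClass (hI : I.comap (projMap G s) = I.comap (actMap G s)) : EquivariantKHomology G s :=
  equivariantKClass (isCoherentModule_closedStructureModule I) (closedEquivariantStructure hI)

theorem closedClass_congr {hI : I.comap (projMap G s) = I.comap (actMap G s)}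
    {hJ : J.comap (projMap G s) = J.comap (actMap G s)} (h : I = J) :
    closedClass hI = closedClass hJ := by
  subst h; rfl

theorem closedClass_top
    (h : (⊤ : X.IdealSheafData).comap (projMap G s) = (⊤ : X.IdealSheafData).comap (actMap G s)) :
    closedClass h = 0 :=
  equivariantKClass_eq_zero _ _ (isQuotientBy_comorphism ⊤).isZero

/-- The class of `X` is that of its closed subscheme with ideal zero, from the exact sequence
`0 → 𝒪_X → 𝒪_X/0 → 𝒪_X/𝒪_X → 0`. -/
theorem equivariantKClass_structureModule {φ : EquivariantStructure G s (structureModule X)}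
    (hφ : φ.iso = structureIso G s)
    (h : (⊥ : X.IdealSheafData).comap (projMap G s) = (⊥ : X.IdealSheafData).comap (actMap G s)) :
    equivariantKClass isCoherentModule_structureModule φ = closedClass h := by
  let q (K : X.IdealSheafData) : structureModule X ⟶ closedStructureModule K :=
    comorphism K.subschemeι
  have hq (K : X.IdealSheafData) : IsQuotientBy (q K) K := isQuotientBy_comorphism K
  have htop : (⊤ : X.IdealSheafData).comap (projMap G s) =
      (⊤ : X.IdealSheafData).comap (actMap G s) := by simp
  have hz : IsZero (closedStructureModule (⊤ : X.IdealSheafData)) := (hq ⊤).isZero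
  have := (hq ⊥).isIso
  have hφc : φ.IsCanonical (𝟙 _) := by simp [EquivariantStructure.IsCanonical, hφ]
  have := mk_eq_add_of_shortExact
    (F₁ := ⟨structureModule X, isCoherentModule_structureModule, φ⟩)
    (F₂ := ⟨closedStructureModule ⊥, isCoherentModule_closedStructureModule ⊥,
      closedEquivariantStructure h⟩)
    (F₃ := ⟨closedStructureModule ⊤, isCoherentModule_closedStructureModule ⊤,
      closedEquivariantStructure htop⟩)
    (i := q ⊥) (q := 0) comp_zero
    ((generates_of_epi (𝟙 (structureModule X))).isEquivariantHom (fun _ => hφc) fun _ => by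
      rw [Category.id_comp]
      exact isCanonical_closedEquivariantStructure h)
    (by simp [IsEquivariantHom])
    { exact := (ShortComplex.exact_iff_epi _ rfl).2 (hq ⊥).epi
      mono_f := inferInstanceAs (Mono (q ⊥))
      epi_g := ⟨fun _ _ _ => hz.eq_of_src _ _⟩ }
  have h0 := closedClass_top htop
  unfold closedClass equivariantKClass at *
  rw [h0, add_zero] at this
  exact this.symm

/-- Inclusion–exclusion, from the Mayer–Vietoris sequence and the split sequence of
`𝒪/I ⊕ 𝒪/J`. -/
theorem closedClass_inf_add_closedClass_sup
    (hI : I.comap (projMap G s) = I.comap (actMap G s))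
    (hJ : J.comap (projMap G s) = J.comap (actMap G s))
    (hinf : (I ⊓ J).comap (projMap G s) = (I ⊓ J).comap (actMap G s))
    (hsup : (I ⊔ J).comap (projMap G s) = (I ⊔ J).comap (actMap G s)) :
    closedClass hinf + closedClass hsup = closedClass hI + closedClass hJ := by
  let q (K : X.IdealSheafData) : structureModule X ⟶ closedStructureModule K :=
    comorphism K.subschemeι
  have hq (K : X.IdealSheafData) : IsQuotientBy (q K) K := isQuotientBy_comorphism K
  have hepi (K : X.IdealSheafData) : Epi (q K) := (hq K).epi
  let E {K : X.IdealSheafData} (hK : K.comap (projMap G s) = K.comap (actMap G s)) :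
      EquivariantCoherentModule G s :=
    ⟨closedStructureModule K, isCoherentModule_closedStructureModule K,
      closedEquivariantStructure hK⟩
  have hE {K : X.IdealSheafData} (hK : K.comap (projMap G s) = K.comap (actMap G s)) :
      (E hK).equivariant.IsCanonical (q K) := isCanonical_closedEquivariantStructure hK
  obtain ⟨rI, hrI⟩ := (hq (I ⊓ J)).exists_factor (hq I) inf_le_left
  obtain ⟨rJ, hrJ⟩ := (hq (I ⊓ J)).exists_factor (hq J) inf_le_right
  obtain ⟨tI, htI⟩ := (hq I).exists_factor (hq (I ⊔ J)) le_sup_left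
  obtain ⟨tJ, htJ⟩ := (hq J).exists_factor (hq (I ⊔ J)) le_sup_right
  obtain ⟨Φ, hΦ, hΦ'⟩ := (hE hI).exists_biprod (hE hJ)
  let B : EquivariantCoherentModule G s :=
    ⟨closedStructureModule I ⊞ closedStructureModule J,
      (isCoherentModule_closedStructureModule I).biprod (isCoherentModule_closedStructureModule J)
        (q I) (q J), Φ⟩
  have w := (hq (I ⊓ J)).comp_sub_eq_zero hrI hrJ htI htJ
  have hB : ∀ b : Bool, B.equivariant.IsCanonical
      (bif b then q I ≫ biprod.inl else q J ≫ biprod.inr) := by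
    rintro (_ | _); exacts [hΦ', hΦ]
  have h1 := mk_eq_add_of_shortExact (F₁ := E hinf) (F₂ := B) (F₃ := E hsup) w
    ((generates_of_epi (q (I ⊓ J))).isEquivariantHom (fun _ => hE hinf) fun _ => by
      rw [Preadditive.comp_add, reassoc_of% hrI, reassoc_of% hrJ]
      exact hΦ.add hΦ')
    ((generates_biprod (q I) (q J)).isEquivariantHom hB (by
      rintro (_ | _)
      · simpa [htJ] using (hE hsup).neg
      · simpa [htI] using hE hsup))
    ((hq I).shortExact (hq J) (hq (I ⊓ J)) (hq (I ⊔ J)) hrI hrJ htI htJ w)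
  have h2 := mk_eq_add_of_shortExact (F₁ := E hI) (F₂ := B) (F₃ := E hJ)
    (i := biprod.inl) (q := biprod.snd) biprod.inl_snd
    ((generates_of_epi (q I)).isEquivariantHom (fun _ => hE hI) fun _ => hΦ)
    ((generates_biprod (q I) (q J)).isEquivariantHom hB (by
      rintro (_ | _)
      · simpa using hE hJ
      · simpa using EquivariantStructure.isCanonical_zero))
    (ShortComplex.Splitting.ofHasBinaryBiproduct _ _).shortExact
  exact h1.symm.trans h2

end Classes
end

noncomputable section

/-! ### The Möbius formula -/

section Formula

open Scheme

variable {X : Scheme.{u}}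

/-- The ideal sheaf of the union of the members of an order ideal of the minimal family. -/
def unionIdeal (D : LowerSet (minimalFamily X)) : X.IdealSheafData :=
  ⨅ B ∈ D, varietyIdeal B.1

theorem unionIdeal_bot : unionIdeal (⊥ : LowerSet (minimalFamily X)) = ⊤ := by
  simp [unionIdeal]

theorem unionIdeal_sup (D E : LowerSet (minimalFamily X)) :
    unionIdeal (D ⊔ E) = unionIdeal D ⊓ unionIdeal E := by
  simp only [unionIdeal, LowerSet.mem_sup_iff, iInf_or, iInf_inf_eq]

theorem unionIdeal_Iic (A : minimalFamily X) :
    unionIdeal (LowerSet.Iic A) = varietyIdeal A.1 := by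
  have hA : A ∈ LowerSet.Iic A := le_rfl (a := A)
  refine le_antisymm (iInf₂_le (f := fun (B : minimalFamily X) (_ : B ∈ LowerSet.Iic A) =>
    varietyIdeal B.1) A hA) (le_iInf₂ fun B hB => ?_)
  have hBA : B ≤ A := hB
  exact IdealSheafData.vanishingIdeal_antimono
    (show (⟨B.1, B.1.isClosed⟩ : Closeds X) ≤ ⟨A.1, A.1.isClosed⟩ from hBA)

theorem unionIdeal_eq_vanishingIdeal {D : LowerSet (minimalFamily X)} {Z : Closeds X}
    (hZ : (Z : Set X) = ⋃ B ∈ D, (B.1 : Set X)) :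
    unionIdeal D = IdealSheafData.vanishingIdeal Z := by
  rw [← biInf_varietyIdeal (T := Subtype.val '' (D : Set (minimalFamily X))) Z]
  · rw [iInf_image]
    rfl
  · rw [hZ, Set.biUnion_image]
    rfl

theorem unionIdeal_top [AlgebraicGeometry.IsReduced X] :
    unionIdeal (⊤ : LowerSet (minimalFamily X)) = ⊥ := by
  rw [unionIdeal_eq_vanishingIdeal (Z := ⊤)]
  · simp [nilradical_eq_bot]
  · refine (Set.eq_univ_of_forall fun x => ?_).symm
    obtain ⟨C, hC, hx⟩ := Set.mem_iUnion₂.1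
      ((coe_eq_biUnion_isComponentOf (⊤ : Closeds X)).le (Set.mem_univ x))
    have hC' : C ∈ minimalFamily X :=
      intersectDecompose_minimalFamily ∅ (Set.empty_subset _) C (by simpa using hC)
    exact Set.mem_biUnion (show (⟨C, hC'⟩ : minimalFamily X) ∈ (⊤ : LowerSet _) from trivial) hx

/-- The scheme-theoretic intersection of the union of `D` with `A` is the union of the members of
`D` that lie in `A`: the components of `A ∩ B`, for `B` in `D`, are such members. -/
theorem HasReducedIntersections.unionIdeal_inf_Iic [NoetherianSpace X]
    (hX : HasReducedIntersections X) (D : LowerSet (minimalFamily X)) (A : minimalFamily X) :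
    unionIdeal (D ⊓ LowerSet.Iic A) = unionIdeal D ⊔ varietyIdeal A.1 := by
  let Z : Closeds X := ⟨⋃ B ∈ D, (B.1 : Set X),
    (Set.toFinite (D : Set (minimalFamily X))).isClosed_biUnion fun B _ => B.1.isClosed⟩
  have hZ : (Z : Set X) = ⋃ B ∈ Subtype.val '' (D : Set (minimalFamily X)), (B : Set X) := by
    rw [Set.biUnion_image]
    rfl
  rw [unionIdeal_eq_vanishingIdeal (D := D) (Z := Z) rfl, sup_comm,
    hX.sup_vanishingIdeal A.2 (by rintro _ ⟨B, -, rfl⟩; exact B.2) Z hZ]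
  refine unionIdeal_eq_vanishingIdeal (Set.Subset.antisymm ?_ (Set.iUnion₂_subset ?_))
  · rintro x ⟨hxA, hxZ⟩
    obtain ⟨B, hB, hxB⟩ := Set.mem_iUnion₂.1 hxZ
    obtain ⟨C, hC, hxC⟩ := Set.mem_iUnion₂.1 ((coe_eq_biUnion_isComponentOf
      ((⟨A.1, A.1.isClosed⟩ : Closeds X) ⊓ ⟨B.1, B.1.isClosed⟩)).le ⟨hxA, hxB⟩)
    have hC' : C ∈ minimalFamily X := by
      refine intersectDecompose_minimalFamily {A.1, B.1} ?_ C ?_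
      · rintro _ (rfl | rfl); exacts [A.2, B.2]
      · rw [Set.biInter_pair]
        exact hC
    have hCD : (⟨C, hC'⟩ : minimalFamily X) ∈ D ⊓ LowerSet.Iic A :=
      ⟨D.lower (show (⟨C, hC'⟩ : minimalFamily X) ≤ B from hC.1.trans Set.inter_subset_right) hB,
        hC.1.trans Set.inter_subset_left⟩
    exact Set.mem_biUnion hCD hxC
  · exact fun B hB => Set.subset_inter hB.2 (Set.subset_biUnion_of_mem (u := fun B :
      minimalFamily X => (B.1 : Set X)) hB.1)

section Equivariant

variable {S : Scheme.{u}} (G : Over S) [GrpObj G] (s : X ⟶ S) [ModObj G (Over.mk s)]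

theorem comap_unionIdeal [NoetherianSpace X] [AlgebraicGeometry.Flat G.hom]
    (h : ∀ A ∈ minimalFamily X, Preserves G s (varietyIdeal A))
    (D : LowerSet (minimalFamily X)) :
    (unionIdeal D).comap (projMap G s) = (unionIdeal D).comap (actMap G s) := by
  have key (T : Set (minimalFamily X)) : (⨅ B ∈ T, varietyIdeal B.1).comap (projMap G s) =
      (⨅ B ∈ T, varietyIdeal B.1).comap (actMap G s) := by
    induction T, T.toFinite using Set.Finite.induction_on with
    | empty => simp
    | @insert A T _ _ ih =>
      rw [iInf_insert, comap_inf_of_flat, comap_inf_of_flat, ih,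
        comap_actMap_eq_of_preserves G s (h A.1 A.2)]
  exact key D

/-- The Möbius formula for any family with the intersect-decompose property whose members are
preserved. -/
theorem equivariantKClass_eq_sum [NoetherianSpace X] [AlgebraicGeometry.IsReduced X]
    [AlgebraicGeometry.Flat G.hom]
    (hX : HasReducedIntersections X) {P : Finset (IrreducibleCloseds X)}
    (hP : IntersectDecompose (P : Set (IrreducibleCloseds X)))
    (hG : ∀ A : P, (varietyIdeal A.1).comap (projMap G s) = (varietyIdeal A.1).comap (actMap G s))
    (h : ∀ A ∈ minimalFamily X, Preserves G s (varietyIdeal A))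
    {φ : EquivariantStructure G s (structureModule X)} (hφ : φ.iso = structureIso G s) :
    equivariantKClass isCoherentModule_structureModule φ =
      ∑ A : P, moebiusFn P A • closedClass (hG A) := by
  have := Fintype.ofFinite (minimalFamily X)
  have hc := eq_sum_moebiusFn_of_valuation
    (fun D : LowerSet (minimalFamily X) => closedClass (comap_unionIdeal G s h D))
    ((closedClass_congr unionIdeal_bot).trans (closedClass_top (by simp))) fun D A => by
      have hinf : (unionIdeal D ⊓ unionIdeal (LowerSet.Iic A)).comap (projMap G s) =
          (unionIdeal D ⊓ unionIdeal (LowerSet.Iic A)).comap (actMap G s) := by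
        rw [← unionIdeal_sup]
        exact comap_unionIdeal G s h _
      have hsup : (unionIdeal D ⊔ unionIdeal (LowerSet.Iic A)).comap (projMap G s) =
          (unionIdeal D ⊔ unionIdeal (LowerSet.Iic A)).comap (actMap G s) := by
        rw [unionIdeal_Iic, ← hX.unionIdeal_inf_Iic]
        exact comap_unionIdeal G s h _
      rw [closedClass_congr (hI := comap_unionIdeal G s h (D ⊔ LowerSet.Iic A)) (hJ := hinf)
          (unionIdeal_sup _ _),
        closedClass_congr (hI := comap_unionIdeal G s h (D ⊓ LowerSet.Iic A)) (hJ := hsup)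
          ((hX.unionIdeal_inf_Iic D A).trans (by rw [unionIdeal_Iic])),
        closedClass_inf_add_closedClass_sup]
  rw [equivariantKClass_structureModule hφ (by simp),
    ← closedClass_congr (hI := comap_unionIdeal G s h ⊤) unionIdeal_top, hc]
  let e (A : minimalFamily X) : P := ⟨A.1, minimalFamily_subset hP A.2⟩
  have he : Function.Injective e := fun A B h => Subtype.ext (congrArg (fun A : P => A.1) h)
  rw [moebiusFn_eq_extend_minimalFamily hP]
  refine Fintype.sum_of_injective e he _ _ (fun A hA => ?_) fun A => ?_
  · rw [Function.extend_apply' _ _ _ hA]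
    exact zero_smul _ _
  · rw [he.extend_apply, closedClass_congr (unionIdeal_Iic A)]

end Equivariant

/-- Forgetting the equivariant structure. -/
def forgetEquivariant {S : Scheme.{u}} (G : Over S) [GrpObj G] (s : X ⟶ S)
    [ModObj G (Over.mk s)] : EquivariantKHomology G s →+ KHomology X :=
  QuotientAddGroup.map _ _ (FreeAbelianGroup.map fun F => ⟨F.sheaf, F.isCoherent⟩) (by
    refine (AddSubgroup.closure_le _).2 ?_
    rintro _ ⟨F₁, F₂, F₃, i, q, w, -, -, h, rfl⟩
    refine AddSubgroup.subset_closure ⟨⟨F₁.sheaf, F₁.isCoherent⟩, ⟨F₂.sheaf, F₂.isCoherent⟩,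
      ⟨F₃.sheaf, F₃.isCoherent⟩, i, q, w, h, ?_⟩
    simp)

theorem forgetEquivariant_equivariantKClass {S : Scheme.{u}} {G : Over S} [GrpObj G] {s : X ⟶ S}
    [ModObj G (Over.mk s)] {F : X.Modules} (hF : IsCoherentModule F)
    (φ : EquivariantStructure G s F) :
    forgetEquivariant G s (equivariantKClass hF φ) = kClass F hF := by
  refine congrArg QuotientAddGroup.mk (FreeAbelianGroup.map_of_apply _)

/-- The trivial group preserves every closed subscheme. -/
theorem preserves_trivial (I : X.IdealSheafData) : Preserves (𝟙_ (Over X)) (𝟙 X) I := by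
  rw [preserves_iff]
  have : actMap (𝟙_ (Over X)) (𝟙 X) = projMap (𝟙_ (Over X)) (𝟙 X) :=
    congrArg CommaMorphism.left (leftUnitor_hom (Over.mk (𝟙 X)))
  rw [this]

theorem flat_trivial : AlgebraicGeometry.Flat (𝟙_ (Over X)).hom :=
  inferInstanceAs (AlgebraicGeometry.Flat (𝟙 X))

end Formula

theorem mainTheorem1 {X : Scheme.{u}} [AlgebraicGeometry.IsNoetherian X]
    [AlgebraicGeometry.IsReduced X] (hX : HasReducedIntersections X)
    (P : Finset (IrreducibleCloseds X))
    (hP : IntersectDecompose (P : Set (IrreducibleCloseds X))) :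
    -- the values of the Möbius function
    (∀ A : P, A.1 ∉ minimalFamily X → moebiusFn P A = 0) ∧
    (∀ (A : P) (hA : A.1 ∈ minimalFamily X),
      moebiusFn P A = moebiusFn (minimalFamily X) ⟨A.1, hA⟩) ∧
    -- the structure sheaves of `X` and of the members of `P` are coherent, so have classes, and:
    (∃ (hO : IsCoherentModule (structureModule X))
      (hA : ∀ A : P, IsCoherentModule (closedStructureModule (varietyIdeal A.1))),
      -- the formula in `K`-homology
      kClass (structureModule X) hO =
        ∑ A : P, moebiusFn P A • kClass (closedStructureModule (varietyIdeal A.1)) (hA A) ∧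
      -- the formula in equivariant `K`-homology, for the canonical equivariant structures
      ∀ (S : Scheme.{u}) (G : Over S) [GrpObj G] [AlgebraicGeometry.Flat G.hom] (s : X ⟶ S)
        [ModObj G (Over.mk s)],
        (∀ A ∈ P, Preserves G s (varietyIdeal A)) →
        ∃ (φ : EquivariantStructure G s (structureModule X))
          (ψ : ∀ A : P, EquivariantStructure G s (closedStructureModule (varietyIdeal A.1))),
          φ.iso = structureIso G s ∧
          (∀ A : P, (ψ A).IsCanonical (comorphism (varietyIdeal A.1).subschemeι)) ∧
          equivariantKClass hO φ =
            ∑ A : P, moebiusFn P A • equivariantKClass (hA A) (ψ A)) ∧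
    -- connected algebraic groups preserve every member of the minimal family
    (∀ (k : Type u) [Field k] (G : Over (Spec (CommRingCat.of k))) [GrpObj G]
      [AlgebraicGeometry.LocallyOfFiniteType G.hom] [ConnectedSpace G.left]
      (s : X ⟶ Spec (CommRingCat.of k)) [ModObj G (Over.mk s)],
      ∀ A ∈ minimalFamily X, Preserves G s (varietyIdeal A)) := by
  let e (A : minimalFamily X) : P := ⟨A.1, minimalFamily_subset hP A.2⟩
  have he : Function.Injective e := fun A B h => Subtype.ext (congrArg (fun A : P => A.1) h)
  have hμ : moebiusFn P = Function.extend e (moebiusFn (minimalFamily X)) 0 :=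
    moebiusFn_eq_extend_minimalFamily hP
  refine ⟨fun A hA => ?_, fun A hA => ?_, ⟨isCoherentModule_structureModule,
    fun A => isCoherentModule_closedStructureModule _, ?_, ?_⟩,
    fun k _ G _ _ _ s _ A hA => preserves_of_mem_minimalFamily G s hX A hA⟩
  · rw [hμ]
    refine Function.extend_apply' _ _ _ ?_
    rintro ⟨B, rfl⟩
    exact hA B.2
  · rw [hμ]
    exact he.extend_apply _ _ ⟨A.1, hA⟩
  · -- the equivariant formula for the trivial group
    have := flat_trivial (X := X)
    have hG (A : IrreducibleCloseds X) := preserves_trivial (varietyIdeal A)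
    obtain ⟨φ, hφ⟩ := exists_equivariantStructure_structureModule (G := 𝟙_ (Over X)) (s := 𝟙 X)
    have h := equivariantKClass_eq_sum (𝟙_ (Over X)) (𝟙 X) hX hP
      (fun A => (comap_actMap_eq_of_preserves _ _ (hG A.1)).symm) (fun A _ => hG A) hφ
    have h' := congrArg (forgetEquivariant (𝟙_ (Over X)) (𝟙 X)) h
    simpa only [map_sum, map_zsmul, closedClass, forgetEquivariant_equivariantKClass] using h'
  · intro S G _ _ s _ hG
    obtain ⟨φ, hφ⟩ := exists_equivariantStructure_structureModule (G := G) (s := s)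
    exact ⟨φ, fun A => closedEquivariantStructure
        (comap_actMap_eq_of_preserves G s (hG A.1 A.2)).symm, hφ,
      fun A => isCanonical_closedEquivariantStructure _,
      equivariantKClass_eq_sum G s hX hP _
        (fun A hA => hG A (minimalFamily_subset hP hA)) hφ⟩

end
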